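/- Let $m\ge 1$ be an integer and $\Omega_m=\{0,1,\dots,m\}$. For $q\in(1,m+1]$ a $q$-expansion of $x$ is a sequence $(c_i)_{i\ge1}\in\Omega_m^{\mathbb N}$ with $x=\sum_{i\ge1}c_iq^{-i}$. Let $\mathcal U_q$ be the set of $x\in[0,\frac m{q-1}]$ that have a unique $q$-expansion, $\mathcal U_q'\subseteq\Omega_m^{\mathbb N}$ the set of these unique expansions, $\mathcal U=\{q\in(1,m+1]:1\in\mathcal U_q\}$ and $\overline{\mathcal U}$ its closure in $\mathbb R$. Put $M=\lfloor m/2\rfloor+1$. The reflection of a word or sequence is obtained by replacing every digit $c$ by $m-c$; it is written $\overline{\,\cdot\,}$. Write $w^+$ (resp. $w^-$) for the word $w$ with its last digit increased (resp. decreased) by $1$. Words of equal length and sequences are compared lexicographically. A sequence is infinite if it has no last nonzero digit, and $\alpha(q)$ denotes the quasi-greedy expansion of $1$, i.e. the largest infinite $q$-expansion of $1$. Let $(q_0,q_0^*)$ be a connected component of $(M,m+1]\setminus\overline{\mathcal U}$ with $q_0>M$, and let $\alpha(q_0)=(a_1\cdots a_n)^\infty$, where $a_1\cdots a_n$ is the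 smallest periodic block. Define the words $c_\ell$ by $$c_0^-=a_1\cdots a_n,\quad\text{i.e. } c_0=a_1\cdots a_n^+,\qquad c_{\ell+1}=c_\ell\,\overline{c_\ell}^{\,+}\quad(\ell\ge0).$$ A word $u_1\cdots u_p\in\Omega_m^p$ ($p\ge1$) is called matched to $a_1\cdots a_n$ if $u_p<m$ and for every $1\le\ell\le p$ the word $v^{(\ell)}$ consisting of the digits number $\ell+1,\dots,\ell+n$ of $u_1\cdots u_pa_1\cdots a_n$ satisfies $$v^{(\ell)}\le a_1\cdots a_n\ \text{ whenever } u_1\cdots u_\ell\ne m^\ell,\qquad v^{(\ell)}\ge\overline{a_1\cdots a_n}\ \text{ whenever } u_1\cdots u_\ell\ne0^\ell .$$ **Theorem.** Let $(b_i)\in\Omega_m^{\mathbb N}$. Then $(b_i)\in\mathcal U_{q_0^*}'\setminus\mathcal U_{q_0}'$ if and only if $(b_i)$ or its reflection $\overline{(b_i)}$ is an infinite sequence of the form $$\omega\,(c_0^-)^j\,(c_{i_1}\overline{c_{i_1}})^{j_1}(c_{i_1}\overline{c_{i_2}})^{l_1}(c_{i_2}\overline{c_{i_2}})^{j_2}(c_{i_2}\overline{c_{i_3}})^{l_2}\cdots,$$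 where $\omega$ is a word matched to $a_1\cdots a_n$, $j\in\{0,\infty\}$, $0\le i_1<i_2<\cdots$ are integers, and $0\le j_r\le\infty$ and $l_r\in\{0,1\}$ for all $r\ge1$. (If an exponent is $\infty$, whatever follows that power is disregarded; if all exponents are finite, the product must contain infinitely many nonempty factors, so that it is an infinite sequence.) -/

import Mathlib

/-!
Expansions in non-integer bases over the alphabet `{0, 1, …, m}`, modelled by `Fin (m + 1)`.
Infinite sequences are functions `ℕ → Fin (m + 1)` (the digit with index `i` is the coefficient of
`q ^ (-(i + 1))`), finite words are lists.
-/

namespace QExpansion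

variable {m : ℕ}

/-- The sequence `c` is a `q`-expansion of `x`, i.e. `x = ∑_{i ≥ 1} c_i / q ^ i`. -/
def IsExpansion (q x : ℝ) (c : ℕ → Fin (m + 1)) : Prop :=
  HasSum (fun i : ℕ => ((c i : ℕ) : ℝ) / q ^ (i + 1)) x

/-- `U_q`: the points of `[0, m / (q - 1)]` which have a unique `q`-expansion. -/
def univoqueSet (m : ℕ) (q : ℝ) : Set ℝ :=
  {x | x ∈ Set.Icc (0 : ℝ) ((m : ℝ) / (q - 1)) ∧ ∃! c : ℕ → Fin (m + 1), IsExpansion q x c}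

/-- `U'_q`: the set of the `q`-expansions of the elements of `U_q`. -/
def univoqueSeqs (m : ℕ) (q : ℝ) : Set (ℕ → Fin (m + 1)) :=
  {c | ∃ x ∈ univoqueSet m q, IsExpansion q x c}

/-- `U`: the set of univoque bases. -/
def univoqueBases (m : ℕ) : Set ℝ :=
  {q | q ∈ Set.Ioc (1 : ℝ) ((m : ℝ) + 1) ∧ (1 : ℝ) ∈ univoqueSet m q}

/-- `(M, m + 1] ∖ closure U`, where `M = ⌊m / 2⌋ + 1`. -/
def complementSet (m : ℕ) : Set ℝ :=
  Set.Ioc (((m / 2 + 1 : ℕ)) : ℝ) ((m : ℝ) + 1) \ closure (univoqueBases m)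

/-- The open interval `(p, r)` is a connected component of the subset `S` of the real line. -/
def IsComponentInterval (S : Set ℝ) (p r : ℝ) : Prop :=
  ∃ x ∈ S, connectedComponentIn S x = Set.Ioo p r

/-- A sequence is infinite if it does not have a last nonzero digit. -/
def IsInfinite (c : ℕ → Fin (m + 1)) : Prop :=
  ¬ ∃ i, c i ≠ 0 ∧ ∀ k, i < k → c k = 0

/-- `c` is the quasi-greedy expansion of `x`: the lexicographically largest infinite
`q`-expansion of `x`. -/
def IsQuasiGreedy (q x : ℝ) (c : ℕ → Fin (m + 1)) : Prop :=
  IsExpansion q x c ∧ IsInfinite c ∧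
    ∀ d : ℕ → Fin (m + 1), IsExpansion q x d → IsInfinite d → toLex d ≤ toLex c

/-- The reflection `(m - b_i)` of a sequence. -/
def reflectSeq (b : ℕ → Fin (m + 1)) : ℕ → Fin (m + 1) := fun i => (b i).rev

/-- The reflection of a word. -/
def reflect (w : List (Fin (m + 1))) : List (Fin (m + 1)) := w.map Fin.rev

/-- The word `w⁺`: the last digit is increased by one (meaningful if that digit is less than `m`).
-/
def incrLast : List (Fin (m + 1)) → List (Fin (m + 1))
  | [] => []
  | [x] => [x + 1]
  | x :: y :: t => x :: incrLast (y :: t)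

/-- The words `c_ℓ` generated by `c₀⁻ = a`: `c₀ = a⁺` and `c_{ℓ+1} = c_ℓ (reflection of c_ℓ)⁺`. -/
def blockWord (a : List (Fin (m + 1))) : ℕ → List (Fin (m + 1))
  | 0 => incrLast a
  | l + 1 => blockWord a l ++ incrLast (reflect (blockWord a l))

/-- The infinite sequence `w^∞` (for a nonempty word `w`). -/
def periodicSeq (w : List (Fin (m + 1))) : ℕ → Fin (m + 1) :=
  fun i => w.getD (i % w.length) 0

/-- The sequence `w s`: the word `w` followed by the sequence `s`. -/
def appendSeq (w : List (Fin (m + 1))) (s : ℕ → Fin (m + 1)) : ℕ → Fin (m + 1) :=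
  fun i => if i < w.length then w.getD i 0 else s (i - w.length)

/-- `a` is the smallest periodic block of the sequence `s`: `s = a^∞`, and no positive number
smaller than the length of `a` is a period of `s`. -/
def IsSmallestBlock (a : List (Fin (m + 1))) (s : ℕ → Fin (m + 1)) : Prop :=
  a ≠ [] ∧ s = periodicSeq a ∧ ∀ p : ℕ, 0 < p → (∀ i, s (i + p) = s i) → a.length ≤ p

/-- The word `u` is matched to the word `a` of length `n`: it is nonempty, its last digit is less
than `m`, and for `1 ≤ l ≤ |u|` the block of length `n` which starts after the first `l` digits of
`u a` satisfies the two stated lexicographic inequalities (between words of equal length). -/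
def Matched (a u : List (Fin (m + 1))) : Prop :=
  (∃ h : u ≠ [], u.getLast h < Fin.last m) ∧
  ∀ l : ℕ, 1 ≤ l → l ≤ u.length →
    (u.take l ≠ List.replicate l (Fin.last m) → ((u ++ a).drop l).take a.length ≤ a) ∧
    (u.take l ≠ List.replicate l 0 → reflect a ≤ ((u ++ a).drop l).take a.length)

/-- The finite word `w_0^{e_0} w_1^{e_1} … w_{N-1}^{e_{N-1}}` (for finite exponents). -/
def finProd (F : ℕ → List (Fin (m + 1)) × ℕ∞) (N : ℕ) : List (Fin (m + 1)) :=
  ((List.range N).map fun s => (List.replicate (F s).2.toNat (F s).1).flatten).flatten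

/-- The infinite sequence `b` equals `w_0^{e_0} w_1^{e_1} w_2^{e_2} …`, where `F s = (w_s, e_s)` and
`e_s ∈ {0, 1, …, ∞}`. If some exponent is `∞`, the sequence ends with the first such power, and
what follows it is disregarded. If all exponents are finite, the lengths of the finite partial
products have to be unbounded, so that they determine an infinite sequence. -/
def IsInfProd (F : ℕ → List (Fin (m + 1)) × ℕ∞) (b : ℕ → Fin (m + 1)) : Prop :=
  (∃ r, (∀ s, s < r → (F s).2 ≠ ⊤) ∧ (F r).2 = ⊤ ∧
      b = appendSeq (finProd F r) (periodicSeq (F r).1)) ∨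
  ((∀ s, (F s).2 ≠ ⊤) ∧
    (∀ N, ∃ t : ℕ → Fin (m + 1), b = appendSeq (finProd F N) t) ∧
    ∀ L : ℕ, ∃ N, L ≤ (finProd F N).length)

/-- The successive factors of
`(c₀⁻)^j (c_{i_1} c̄_{i_1})^{j_1} (c_{i_1} c̄_{i_2})^{l_1} (c_{i_2} c̄_{i_2})^{j_2} ⋯`
(with `i_1, i_2, …` written `i 0, i 1, …`, and likewise for `j_r` and `l_r`). -/
def factors (a : List (Fin (m + 1))) (j : ℕ∞) (i : ℕ → ℕ) (js : ℕ → ℕ∞) (l : ℕ → ℕ) :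
    ℕ → List (Fin (m + 1)) × ℕ∞
  | 0 => (a, j)
  | s + 1 =>
    if s % 2 = 0 then
      (blockWord a (i (s / 2)) ++ reflect (blockWord a (i (s / 2))), js (s / 2))
    else
      (blockWord a (i (s / 2)) ++ reflect (blockWord a (i (s / 2 + 1))), (l (s / 2) : ℕ∞))

/-- The sequence `b` is of the form
`ω (c₀⁻)^j (c_{i_1} c̄_{i_1})^{j_1} (c_{i_1} c̄_{i_2})^{l_1} (c_{i_2} c̄_{i_2})^{j_2} ⋯`
with `ω` matched to `a`, `j ∈ {0, ∞}`, `0 ≤ i_1 < i_2 < ⋯`, `0 ≤ j_r ≤ ∞` and `0 ≤ l_r ≤ 1`. -/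
def HasForm (a : List (Fin (m + 1))) (b : ℕ → Fin (m + 1)) : Prop :=
  ∃ (w : List (Fin (m + 1))) (j : ℕ∞) (i : ℕ → ℕ) (js : ℕ → ℕ∞) (l : ℕ → ℕ)
    (s : ℕ → Fin (m + 1)),
    Matched a w ∧ (j = 0 ∨ j = ⊤) ∧ StrictMono i ∧ (∀ r, l r ≤ 1) ∧
    IsInfProd (factors a j i js l) s ∧ b = appendSeq w s

end QExpansion

/-!
By the lexicographic description of unique expansions, `b ∈ U'_q` if and only if every tail of `b`
following a digit less than `m` is smaller than `α(q)`, and the same holds for the reflection of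
`b`. The bases of a gap `(q₀, q₀*)` are not univoque and `α(q₀) = (a₁ ⋯ aₙ)^∞`, which forces
`α(q₀*)` to be the limit `c` of the words `c_ℓ`: no sequence strictly between `α(q₀)` and `c`
can be the expansion of `1` in a univoque base, because the doubling `c_{ℓ+1} = c_ℓ c̄_ℓ⁺` leaves no
room for it, whereas `c` itself is such an expansion.

Let `b` satisfy the condition for `q₀*` but not the one for `q₀`. Cut `b` (or its reflection) at the
first tail which is at least `α(q₀)`. Up to there `b` obeys the condition for `q₀`, so that the
initial word, extended by copies of `c₀⁻`, is matched; all tails from there on lie strictly between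
`c̄` and `c`. After an occurrence of `c_i`, these bounds allow only two continuations: the word
`c̄_i`, or the word which completes `c_i` to `c_{i+1}`. Reading off the longest possible words
`c_i` and `c̄_i'` again and again yields the infinite product. Conversely, the admissibility of the
words `c_ℓ` shows that the tails of each such product stay strictly between `c̄` and `c`.
-/

namespace QExpansion

variable {m : ℕ}

/-! ### Sequences and their prefixes -/

section Sequences

variable {A : Type*}

/-- The sequence without its first `k` terms. -/
def shift (k : ℕ) (x : ℕ → A) : ℕ → A := fun i => x (k + i)

@[simp] lemma shift_apply (k i : ℕ) (x : ℕ → A) : shift k x i = x (k + i) := rfl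

@[simp] lemma shift_zero (x : ℕ → A) : shift 0 x = x := by
  funext i; simp

lemma shift_shift (k l : ℕ) (x : ℕ → A) : shift k (shift l x) = shift (l + k) x := by
  funext i; simp [Nat.add_assoc]

/-- The sequences `x` and `y` have the same first `N` terms. -/
def AgreeOn (N : ℕ) (x y : ℕ → A) : Prop := ∀ j < N, x j = y j

namespace AgreeOn

variable {N K : ℕ} {x y z : ℕ → A}

@[refl] lemma refl (N : ℕ) (x : ℕ → A) : AgreeOn N x x := fun _ _ => rfl

lemma symm (h : AgreeOn N x y) : AgreeOn N y x := fun j hj => (h j hj).symm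

lemma trans (h : AgreeOn N x y) (h' : AgreeOn N y z) : AgreeOn N x z :=
  fun j hj => (h j hj).trans (h' j hj)

lemma mono (h : AgreeOn N x y) (hK : K ≤ N) : AgreeOn K x y := fun j hj => h j (hj.trans_le hK)

lemma add (h : AgreeOn N x y) (h' : AgreeOn K (shift N x) (shift N y)) :
    AgreeOn (N + K) x y := by
  intro j hj
  rcases lt_or_ge j N with hjN | hjN
  · exact h j hjN
  · obtain ⟨i, rfl⟩ := Nat.exists_eq_add_of_le hjN
    exact h' i (by omega)

lemma shift (h : AgreeOn (K + N) x y) : AgreeOn N (shift K x) (shift K y) :=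
  fun j hj => h (K + j) (by omega)

end AgreeOn

variable [LinearOrder A]

lemma toLex_lt_iff {x y : ℕ → A} :
    toLex x < toLex y ↔ ∃ k, AgreeOn k x y ∧ x k < y k := Iff.rfl

/-- The prefix of length `N` of `x` is lexicographically smaller than that of `y`. -/
def PrefixLT (N : ℕ) (x y : ℕ → A) : Prop := ∃ k < N, AgreeOn k x y ∧ x k < y k

lemma PrefixLT.lt {N : ℕ} {x y : ℕ → A} (h : PrefixLT N x y) : toLex x < toLex y :=
  let ⟨k, _, hk⟩ := h; ⟨k, hk⟩

lemma PrefixLT.mono {N K : ℕ} {x y : ℕ → A} (h : PrefixLT N x y) (hK : N ≤ K) : PrefixLT K x y :=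
  let ⟨k, hkN, hk⟩ := h; ⟨k, hkN.trans_le hK, hk⟩

lemma PrefixLT.congr {N : ℕ} {x y x' y' : ℕ → A} (h : PrefixLT N x y) (hx : AgreeOn N x x')
    (hy : AgreeOn N y y') : PrefixLT N x' y' := by
  obtain ⟨k, hkN, hk, hlt⟩ := h
  exact ⟨k, hkN, ((hx.mono hkN.le).symm.trans hk).trans (hy.mono hkN.le),
    by rwa [← hx k hkN, ← hy k hkN]⟩

lemma prefixLT_or_agreeOn {x y : ℕ → A} (N : ℕ) (h : toLex x ≤ toLex y) :
    PrefixLT N x y ∨ AgreeOn N x y := by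
  rcases h.eq_or_lt with h | ⟨k, hk, hlt⟩
  · exact Or.inr fun j _ => congrFun (toLex.injective h) j
  · rcases lt_or_ge k N with hkN | hkN
    · exact Or.inl ⟨k, hkN, hk, hlt⟩
    · exact Or.inr fun j hj => hk j (hj.trans_le hkN)

lemma prefixLT_or_agreeOn_of_not {x y : ℕ → A} {N : ℕ} (h : ¬ PrefixLT N y x) :
    PrefixLT N x y ∨ AgreeOn N x y := by
  rcases le_total (toLex x) (toLex y) with hxy | hxy
  · exact prefixLT_or_agreeOn N hxy
  · exact Or.inr ((prefixLT_or_agreeOn N hxy).resolve_left h).symm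

lemma AgreeOn.not_prefixLT {N : ℕ} {x y : ℕ → A} (h : AgreeOn N x y) : ¬ PrefixLT N x y :=
  fun ⟨k, hkN, _, hlt⟩ => hlt.ne (h k hkN)

lemma AgreeOn.prefixLT_add {N K : ℕ} {x y : ℕ → A} (h : AgreeOn N x y)
    (h' : PrefixLT K (QExpansion.shift N x) (QExpansion.shift N y)) : PrefixLT (N + K) x y :=
  let ⟨k, hkK, hk, hlt⟩ := h'; ⟨N + k, by omega, h.add hk, hlt⟩

lemma AgreeOn.shift_lt_shift_iff {N : ℕ} {x y : ℕ → A} (h : AgreeOn N x y) :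
    toLex (QExpansion.shift N x) < toLex (QExpansion.shift N y) ↔ toLex x < toLex y := by
  refine ⟨fun ⟨k, hk, hlt⟩ => ⟨N + k, h.add hk, hlt⟩, fun ⟨k, hk, hlt⟩ => ?_⟩
  have hNk : N ≤ k := not_lt.1 fun hkN => hlt.ne (h k hkN)
  obtain ⟨i, rfl⟩ := Nat.exists_eq_add_of_le hNk
  exact ⟨i, AgreeOn.shift hk, hlt⟩

lemma PrefixLT.trans {N : ℕ} {x y z : ℕ → A} (h : PrefixLT N x y) (h' : PrefixLT N y z) :
    PrefixLT N x z := by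
  obtain ⟨k, hkN, hk, hklt⟩ := h
  obtain ⟨l, hlN, hl, hllt⟩ := h'
  rcases lt_trichotomy k l with hkl | rfl | hkl
  · exact ⟨k, hkN, hk.trans (hl.mono hkl.le), hklt.trans_eq (hl k hkl)⟩
  · exact ⟨k, hkN, hk.trans hl, hklt.trans hllt⟩
  · exact ⟨l, hlN, (hk.mono hkl.le).trans hl, (hk l hkl).trans_lt hllt⟩

lemma PrefixLT.trans_of_not {N : ℕ} {x y z : ℕ → A} (h : ¬ PrefixLT N y x)
    (h' : PrefixLT N y z) : PrefixLT N x z := by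
  rcases prefixLT_or_agreeOn_of_not h with hxy | hxy
  · exact hxy.trans h'
  · exact h'.congr hxy.symm (AgreeOn.refl N z)

end Sequences

section Reflection

@[simp] lemma reflectSeq_apply (x : ℕ → Fin (m + 1)) (i : ℕ) : reflectSeq x i = (x i).rev := rfl

@[simp] lemma reflectSeq_reflectSeq (x : ℕ → Fin (m + 1)) : reflectSeq (reflectSeq x) = x := by
  funext i; simp

@[simp] lemma shift_reflectSeq (k : ℕ) (x : ℕ → Fin (m + 1)) :
    shift k (reflectSeq x) = reflectSeq (shift k x) := rfl

variable {N : ℕ} {x y : ℕ → Fin (m + 1)}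

@[simp] lemma agreeOn_reflectSeq_iff : AgreeOn N (reflectSeq x) (reflectSeq y) ↔ AgreeOn N x y := by
  simp [AgreeOn]

@[simp] lemma prefixLT_reflectSeq_iff :
    PrefixLT N (reflectSeq x) (reflectSeq y) ↔ PrefixLT N y x := by
  simp [PrefixLT, AgreeOn, eq_comm]

lemma reflectSeq_lt_reflectSeq_iff :
    toLex (reflectSeq x) < toLex (reflectSeq y) ↔ toLex y < toLex x := by
  simp [toLex_lt_iff, AgreeOn, eq_comm]

lemma reflectSeq_lt_comm : toLex (reflectSeq x) < toLex y ↔ toLex (reflectSeq y) < toLex x := by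
  rw [← reflectSeq_lt_reflectSeq_iff, reflectSeq_reflectSeq]

end Reflection

/-- The prefix of length `N` of `v` is `w⁺`, where `w` is the prefix of length `N` of `u`. -/
structure PrefixSucc (N : ℕ) (u v : ℕ → Fin (m + 1)) : Prop where
  pos : 0 < N
  agreeOn : AgreeOn (N - 1) u v
  last : (v (N - 1) : ℕ) = u (N - 1) + 1

namespace PrefixSucc

variable {N : ℕ} {u v y : ℕ → Fin (m + 1)}

lemma prefixLT (h : PrefixSucc N u v) : PrefixLT N u v :=
  ⟨N - 1, Nat.sub_one_lt h.pos.ne', h.agreeOn, by rw [Fin.lt_def, h.last]; omega⟩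

lemma shift (h : PrefixSucc N u v) {i : ℕ} (hi : i < N) :
    PrefixSucc (N - i) (shift i u) (shift i v) where
  pos := by omega
  agreeOn j hj := h.agreeOn (i + j) (by omega)
  last := by
    simp only [shift_apply, show i + (N - i - 1) = N - 1 by omega]
    exact h.last

lemma reflectSeq (h : PrefixSucc N u v) : PrefixSucc N (reflectSeq v) (reflectSeq u) where
  pos := h.pos
  agreeOn := agreeOn_reflectSeq_iff.2 h.agreeOn.symm
  last := by
    have := h.last
    simp only [reflectSeq_apply, Fin.val_rev]
    omega

lemma not_prefixLT (h : PrefixSucc N u v) (hy : PrefixLT N u y) : ¬ PrefixLT N y v := by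
  rintro ⟨l, hlN, hl, hllt⟩
  obtain ⟨k, hkN, hk, hklt⟩ := hy
  have hlast := h.last
  rw [Fin.lt_def] at hklt hllt
  rcases lt_trichotomy k l with hkl | rfl | hkl
  · rw [hl k hkl, ← h.agreeOn k (by omega)] at hklt
    exact lt_irrefl _ hklt
  · rcases (Nat.le_sub_one_of_lt hkN).eq_or_lt with rfl | hk1
    · omega
    · rw [← h.agreeOn k hk1] at hllt
      omega
  · rw [← hk l hkl, ← h.agreeOn l (by omega)] at hllt
    exact lt_irrefl _ hllt

lemma agreeOn_or_agreeOn (h : PrefixSucc N u v) (hu : toLex u ≤ toLex y) (hv : toLex y ≤ toLex v) :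
    AgreeOn N y u ∨ AgreeOn N y v := by
  rcases prefixLT_or_agreeOn N hu with hlt | hag
  · exact Or.inr ((prefixLT_or_agreeOn N hv).resolve_left (h.not_prefixLT hlt))
  · exact Or.inl hag.symm

end PrefixSucc

/-! ### Words -/

section Words

variable {A : Type*}

/-- The word formed by the first `N` terms of a sequence. -/
def initWord (N : ℕ) (z : ℕ → A) : List A := (List.range N).map z

@[simp] lemma length_initWord (N : ℕ) (z : ℕ → A) : (initWord N z).length = N := by
  simp [initWord]

lemma initWord_add (N K : ℕ) (z : ℕ → A) :
    initWord (N + K) z = initWord N z ++ initWord K (shift N z) := by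
  simp [initWord, List.range_add, Function.comp_def]

lemma initWord_succ (N : ℕ) (z : ℕ → A) : initWord (N + 1) z = initWord N z ++ [z N] := by
  simp [initWord, List.range_succ]

lemma initWord_eq_initWord_iff {N : ℕ} {x y : ℕ → A} :
    initWord N x = initWord N y ↔ AgreeOn N x y := by
  simp [initWord, AgreeOn]

lemma take_initWord {l N : ℕ} (h : l ≤ N) (z : ℕ → A) :
    (initWord N z).take l = initWord l z := by
  rw [initWord, ← List.map_take, List.take_range, Nat.min_eq_left h, initWord]

lemma drop_initWord_add (l N : ℕ) (z : ℕ → A) :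
    (initWord (l + N) z).drop l = initWord N (shift l z) := by
  rw [initWord_add, List.drop_left' (length_initWord l z)]

lemma initWord_eq_replicate_iff {N : ℕ} {z : ℕ → A} {d : A} :
    initWord N z = List.replicate N d ↔ ∀ j < N, z j = d := by
  simp [List.eq_replicate_iff, initWord]

lemma initWord_lt_initWord_iff [LinearOrder A] {N : ℕ} {x y : ℕ → A} :
    initWord N x < initWord N y ↔ PrefixLT N x y := by
  rw [List.lt_iff_exists]
  constructor
  · rintro (⟨-, h⟩ | ⟨k, hk, hk', hag, hlt⟩)
    · simp at h
    · exact ⟨k, by simpa using hk, fun j hj => by simpa [initWord] using hag j hj,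
        by simpa [initWord] using hlt⟩
  · rintro ⟨k, hk, hag, hlt⟩
    exact Or.inr ⟨k, by simpa using hk, by simpa using hk,
      fun j hj => by simpa [initWord] using hag j hj, by simpa [initWord] using hlt⟩

end Words

lemma reflect_initWord (N : ℕ) (z : ℕ → Fin (m + 1)) :
    reflect (initWord N z) = initWord N (reflectSeq z) := by
  simp [reflect, initWord, Function.comp_def]

lemma incrLast_concat (w : List (Fin (m + 1))) (d : Fin (m + 1)) :
    incrLast (w ++ [d]) = w ++ [d + 1] := by
  induction w with
  | nil => rfl
  | cons x t ih => cases t <;> simp_all [incrLast]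

section AppendSeq

@[simp] lemma appendSeq_nil (s : ℕ → Fin (m + 1)) : appendSeq [] s = s := by
  funext i; simp [appendSeq]

lemma shift_length_add_appendSeq (w : List (Fin (m + 1))) (s : ℕ → Fin (m + 1)) (k : ℕ) :
    shift (w.length + k) (appendSeq w s) = shift k s := by
  funext i
  simp [appendSeq, Nat.add_assoc]

@[simp] lemma shift_length_appendSeq (w : List (Fin (m + 1))) (s : ℕ → Fin (m + 1)) :
    shift w.length (appendSeq w s) = s := by
  simpa using shift_length_add_appendSeq w s 0

lemma appendSeq_injective (w : List (Fin (m + 1))) : Function.Injective (appendSeq w) :=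
  Function.LeftInverse.injective (g := shift w.length) (shift_length_appendSeq w)

lemma appendSeq_append (u v : List (Fin (m + 1))) (s : ℕ → Fin (m + 1)) :
    appendSeq (u ++ v) s = appendSeq u (appendSeq v s) := by
  funext i
  simp only [appendSeq, List.length_append]
  by_cases hu : i < u.length
  · rw [if_pos (by omega), if_pos hu, List.getD_append _ _ _ _ hu]
  · by_cases hv : i - u.length < v.length
    · rw [if_pos (by omega), if_neg hu, if_pos hv, List.getD_append_right _ _ _ _ (by omega)]
    · rw [if_neg (by omega), if_neg hu, if_neg hv, Nat.sub_sub]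

@[simp] lemma initWord_appendSeq (w : List (Fin (m + 1))) (s : ℕ → Fin (m + 1)) :
    initWord w.length (appendSeq w s) = w := by
  refine List.ext_getElem (by simp) fun i hi hi' => ?_
  simp [initWord, appendSeq, hi']

lemma appendSeq_initWord_apply {N i : ℕ} (hi : i < N) (z s : ℕ → Fin (m + 1)) :
    appendSeq (initWord N z) s i = z i := by
  simp [appendSeq, initWord, hi]

lemma agreeOn_appendSeq_initWord (N : ℕ) (z s : ℕ → Fin (m + 1)) :
    AgreeOn N (appendSeq (initWord N z) s) z := fun _ hj => appendSeq_initWord_apply hj z s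

@[simp] lemma shift_appendSeq_initWord (N : ℕ) (z s : ℕ → Fin (m + 1)) :
    shift N (appendSeq (initWord N z) s) = s := by
  simpa using shift_length_appendSeq (initWord N z) s

@[simp] lemma appendSeq_initWord_shift (N : ℕ) (z : ℕ → Fin (m + 1)) :
    appendSeq (initWord N z) (shift N z) = z := by
  funext i
  rcases lt_or_ge i N with hi | hi
  · exact appendSeq_initWord_apply hi z _
  · obtain ⟨k, rfl⟩ := Nat.exists_eq_add_of_le hi
    exact congrFun (shift_appendSeq_initWord N z (shift N z)) k

lemma agreeOn_appendSeq (w : List (Fin (m + 1))) (s t : ℕ → Fin (m + 1)) :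
    AgreeOn w.length (appendSeq w s) (appendSeq w t) :=
  initWord_eq_initWord_iff.1 (by simp only [initWord_appendSeq])

lemma appendSeq_lt_appendSeq_iff (w : List (Fin (m + 1))) {s t : ℕ → Fin (m + 1)} :
    toLex (appendSeq w s) < toLex (appendSeq w t) ↔ toLex s < toLex t := by
  simp [← (agreeOn_appendSeq w s t).shift_lt_shift_iff]

lemma eq_appendSeq_of_initWord_eq {w : List (Fin (m + 1))} {y : ℕ → Fin (m + 1)}
    (h : initWord w.length y = w) : y = appendSeq w (shift w.length y) := by
  conv_lhs => rw [← appendSeq_initWord_shift w.length y, h]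

end AppendSeq

section Periodic

variable (w : List (Fin (m + 1)))

@[simp] lemma shift_length_periodicSeq : shift w.length (periodicSeq w) = periodicSeq w := by
  funext i; simp [periodicSeq]

@[simp] lemma initWord_periodicSeq : initWord w.length (periodicSeq w) = w := by
  refine List.ext_getElem (by simp) fun i hi hi' => ?_
  simp [initWord, periodicSeq, Nat.mod_eq_of_lt hi', hi']

@[simp] lemma appendSeq_periodicSeq : appendSeq w (periodicSeq w) = periodicSeq w := by
  simpa using appendSeq_initWord_shift w.length (periodicSeq w)

@[simp] lemma appendSeq_flatten_replicate_periodicSeq (J : ℕ) :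
    appendSeq (List.replicate J w).flatten (periodicSeq w) = periodicSeq w := by
  induction J with
  | zero => simp
  | succ J ih => simp [List.replicate_succ, appendSeq_append, ih]

variable {w} {y : ℕ → Fin (m + 1)}

lemma eq_appendSeq_replicate {J : ℕ}
    (h : ∀ j < J, initWord w.length (shift (w.length * j) y) = w) :
    y = appendSeq (List.replicate J w).flatten (shift (w.length * J) y) := by
  induction J with
  | zero => simp
  | succ J ih =>
    rw [List.replicate_succ', List.flatten_append, List.flatten_singleton, appendSeq_append,
      Nat.mul_succ, ← shift_shift, ← eq_appendSeq_of_initWord_eq (h J J.lt_succ_self),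
      ← ih fun j hj => h j (hj.trans J.lt_succ_self)]

lemma eq_periodicSeq (hw : w ≠ []) (h : ∀ j, initWord w.length (shift (w.length * j) y) = w) :
    y = periodicSeq w := by
  funext i
  have hlt : i % w.length < w.length := Nat.mod_lt _ (List.length_pos_iff.2 hw)
  have hag := initWord_eq_initWord_iff.1 ((h (i / w.length)).trans (initWord_periodicSeq w).symm)
  have := hag _ hlt
  rwa [shift_apply, Nat.div_add_mod, periodicSeq, Nat.mod_mod] at this

end Periodic

/-! ### Values of expansions -/

/-- The number of which `x` is a `q`-expansion. -/
noncomputable def val (q : ℝ) (x : ℕ → Fin (m + 1)) : ℝ :=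
  ∑' i : ℕ, ((x i : ℕ) : ℝ) / q ^ (i + 1)

section Val

variable {q : ℝ} {x y : ℕ → Fin (m + 1)}

lemma digit_le (a : Fin (m + 1)) : ((a : ℕ) : ℝ) ≤ m := by exact_mod_cast Fin.is_le a

lemma hasSum_div_pow_succ (hq : 1 < q) (r : ℝ) :
    HasSum (fun i : ℕ => r / q ^ (i + 1)) (r / (q - 1)) := by
  have h0 : q ≠ 0 := by linarith
  have h1 : q - 1 ≠ 0 := by linarith
  have hsum : r / (q - 1) = r / q * (1 - q⁻¹)⁻¹ := by
    rw [show 1 - q⁻¹ = (q - 1) / q by field_simp, inv_div]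
    field_simp
  rw [hsum]
  refine ((hasSum_geometric_of_lt_one (inv_nonneg.2 (by linarith))
    (inv_lt_one_of_one_lt₀ hq)).mul_left (r / q)).congr_fun fun i => ?_
  rw [inv_pow, pow_succ]
  field_simp

lemma summable_digits (hq : 1 < q) (x : ℕ → Fin (m + 1)) :
    Summable fun i : ℕ => ((x i : ℕ) : ℝ) / q ^ (i + 1) := by
  refine Summable.of_nonneg_of_le (fun i => by positivity) (fun i => ?_)
    (hasSum_div_pow_succ hq m).summable
  have := digit_le (x i)
  gcongr

lemma isExpansion_iff (hq : 1 < q) {z : ℝ} : IsExpansion q z x ↔ val q x = z :=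
  ⟨fun h => h.tsum_eq, fun h => h ▸ (summable_digits hq x).hasSum⟩

@[simp] lemma val_zero (q : ℝ) : val q (fun _ => (0 : Fin (m + 1))) = 0 := by simp [val]

lemma val_nonneg (hq : 1 < q) (x : ℕ → Fin (m + 1)) : 0 ≤ val q x :=
  tsum_nonneg fun i => by positivity

lemma val_le (hq : 1 < q) (x : ℕ → Fin (m + 1)) : val q x ≤ m / (q - 1) := by
  refine hasSum_le (fun i => ?_) (summable_digits hq x).hasSum (hasSum_div_pow_succ hq m)
  have := digit_le (x i)
  gcongr

lemma digit_pos {a : Fin (m + 1)} (ha : a ≠ 0) : 0 < ((a : ℕ) : ℝ) := by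
  exact_mod_cast Fin.pos_iff_ne_zero.2 ha

lemma val_pos (hq : 1 < q) {k : ℕ} (hk : x k ≠ 0) : 0 < val q x :=
  (summable_digits hq x).tsum_pos (fun i => by positivity) k
    (div_pos (digit_pos hk) (by positivity))

lemma val_reflectSeq (hq : 1 < q) (x : ℕ → Fin (m + 1)) :
    val q (reflectSeq x) = m / (q - 1) - val q x := by
  refine HasSum.tsum_eq ?_
  refine ((hasSum_div_pow_succ hq m).sub (summable_digits hq x).hasSum).congr_fun fun i => ?_
  rw [← sub_div, reflectSeq_apply, Fin.val_rev, Nat.add_sub_add_right,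
    Nat.cast_sub (Fin.is_le (x i))]

lemma val_eq_sum_add (hq : 1 < q) (x : ℕ → Fin (m + 1)) (k : ℕ) :
    val q x = (∑ i ∈ Finset.range k, ((x i : ℕ) : ℝ) / q ^ (i + 1)) +
      val q (shift k x) / q ^ k := by
  rw [val, ← (summable_digits hq x).sum_add_tsum_nat_add k, val, ← tsum_div_const]
  congr 2
  funext i
  rw [shift_apply, Nat.add_comm i k, div_div, ← pow_add, show i + 1 + k = k + i + 1 by ring]

lemma val_shift (hq : 1 < q) (x : ℕ → Fin (m + 1)) (k : ℕ) :
    val q (shift k x) = (((x k : ℕ) : ℝ) + val q (shift (k + 1) x)) / q := by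
  rw [val_eq_sum_add hq (shift k x) 1, shift_shift]
  simp [add_div]

lemma val_sub_val (hq : 1 < q) {k : ℕ} (h : AgreeOn k x y) :
    val q x - val q y = (((x k : ℕ) : ℝ) + val q (shift (k + 1) x) -
      (((y k : ℕ) : ℝ) + val q (shift (k + 1) y))) / q ^ (k + 1) := by
  have hs : (∑ i ∈ Finset.range k, ((x i : ℕ) : ℝ) / q ^ (i + 1)) =
      ∑ i ∈ Finset.range k, ((y i : ℕ) : ℝ) / q ^ (i + 1) :=
    Finset.sum_congr rfl fun i hi => by rw [h i (Finset.mem_range.1 hi)]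
  have : q ≠ 0 := by linarith
  rw [val_eq_sum_add hq x k, val_eq_sum_add hq y k, hs, val_shift hq x, val_shift hq y, pow_succ]
  field_simp
  ring

lemma val_add_le_val (hq : 1 < q) {k : ℕ} (h : AgreeOn k x y) (hlt : x k < y k) :
    val q x + (1 + val q (shift (k + 1) y) - val q (shift (k + 1) x)) / q ^ (k + 1) ≤ val q y := by
  have hdigit : ((x k : ℕ) : ℝ) + 1 ≤ ((y k : ℕ) : ℝ) := by exact_mod_cast hlt
  have hdiff : (1 + val q (shift (k + 1) y) - val q (shift (k + 1) x)) / q ^ (k + 1) ≤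
      val q y - val q x := by
    rw [val_sub_val hq h.symm]
    exact div_le_div_of_nonneg_right (by linarith) (by positivity)
  linarith

lemma val_lt_val_of_base_lt {r : ℝ} (hq : 1 < q) (hqr : q < r) {k : ℕ} (hk : x k ≠ 0) :
    val r x < val q x := by
  have hpos := digit_pos hk
  refine Summable.tsum_lt_tsum (i := k) (fun i => ?_) ?_ (summable_digits (hq.trans hqr) x)
    (summable_digits hq x)
  · gcongr
  · gcongr

/-- Increasing a digit is compensated by lowering the value of the tail by `1`. -/
lemma exists_val_eq_of_lt_last (hq : 1 < q) {t : ℕ → Fin (m + 1)} {k : ℕ} (hk : x k < Fin.last m)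
    (ht : val q t = val q (shift (k + 1) x) - 1) :
    ∃ d, val q d = val q x ∧ toLex x < toLex d ∧ shift (k + 1) d = t := by
  have hkm : (x k : ℕ) < m := hk
  set e : Fin (m + 1) := ⟨x k + 1, by omega⟩ with he
  set d := appendSeq (initWord (k + 1) (Function.update x k e)) t
  have hupdate : AgreeOn (k + 1) d (Function.update x k e) := agreeOn_appendSeq_initWord _ _ _
  have hag : AgreeOn k d x := fun j hj => by
    rw [hupdate j (by omega), Function.update_of_ne hj.ne]
  have hdk : d k = e := by rw [hupdate k k.lt_succ_self, Function.update_self]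
  have htail : shift (k + 1) d = t := shift_appendSeq_initWord _ _ _
  refine ⟨d, sub_eq_zero.1 ?_, ⟨k, hag.symm, ?_⟩, htail⟩
  · rw [val_sub_val hq hag, htail, ht, hdk, he]
    push_cast
    ring
  · simp [hdk, he, Fin.lt_def]

end Val

/-- The sequence has infinitely many nonzero digits: it is infinite and different from `0^∞`. -/
def InfNonzero (x : ℕ → Fin (m + 1)) : Prop := ∀ k, ∃ j, k ≤ j ∧ x j ≠ 0

namespace InfNonzero

variable {x : ℕ → Fin (m + 1)}

lemma shift (h : InfNonzero x) (k : ℕ) : InfNonzero (shift k x) := by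
  intro l
  obtain ⟨j, hj, hx⟩ := h (k + l)
  exact ⟨j - k, by omega, by rwa [shift_apply, show k + (j - k) = j by omega]⟩

lemma of_shift {k : ℕ} (h : InfNonzero (QExpansion.shift k x)) : InfNonzero x := by
  intro l
  obtain ⟨j, hj, hx⟩ := h l
  exact ⟨k + j, by omega, hx⟩

lemma val_pos (h : InfNonzero x) {q : ℝ} (hq : 1 < q) : 0 < val q x :=
  let ⟨_, _, hk⟩ := h 0; QExpansion.val_pos hq hk

lemma isInfinite (h : InfNonzero x) : IsInfinite x := by
  rintro ⟨i, -, hi⟩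
  obtain ⟨j, hj, hx⟩ := h (i + 1)
  exact hx (hi j hj)

end InfNonzero

lemma IsInfinite.infNonzero {x : ℕ → Fin (m + 1)} (h : IsInfinite x) {k : ℕ} (hk : x k ≠ 0) :
    InfNonzero x := by
  intro l
  induction l with
  | zero => exact ⟨k, Nat.zero_le _, hk⟩
  | succ l ih =>
    obtain ⟨j, hj, hx⟩ := ih
    by_contra! hcon
    exact h ⟨j, hx, fun i hi => hcon i (by omega)⟩

/-! ### Quasi-greedy expansions -/

section QuasiGreedy

variable {q : ℝ}

lemma nonpos_of_forall_le_div_pow (hq : 1 < q) {x C : ℝ} (h : ∀ N : ℕ, x ≤ C / q ^ N) : x ≤ 0 :=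
  ge_of_tendsto' ((tendsto_pow_atTop_atTop_of_one_lt hq).const_div_atTop C) h

lemma one_le_div_sub_one (hq : 1 < q) (hqm : q ≤ m + 1) : 1 ≤ (m : ℝ) / (q - 1) := by
  rw [le_div_iff₀ (by linarith)]; linarith

lemma le_add_one_of_val_eq_one (hq : 1 < q) {x : ℕ → Fin (m + 1)} (hx : val q x = 1) :
    q ≤ m + 1 := by
  have h := val_le hq x
  rw [hx, le_div_iff₀ (by linarith)] at h
  linarith

lemma exists_quasiGreedy_digit (hq : 1 < q) (hqm : q ≤ m + 1) {y : ℝ} (hy : 0 < y)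
    (hym : y ≤ m / (q - 1)) :
    ∃ d : Fin (m + 1), 0 < q * y - ((d : ℕ) : ℝ) ∧ q * y - ((d : ℕ) : ℝ) ≤ m / (q - 1) ∧
      (d < Fin.last m → q * y - ((d : ℕ) : ℝ) ≤ 1) := by
  have hqy : 0 < q * y := by positivity
  obtain ⟨c, hc⟩ := Nat.exists_eq_add_one.2 (Nat.ceil_pos.2 hqy)
  have hlt : (c : ℝ) < q * y := by rw [← Nat.lt_ceil]; omega
  have hle : q * y ≤ c + 1 := by exact_mod_cast hc ▸ Nat.le_ceil (q * y)
  have hone : 1 ≤ (m : ℝ) / (q - 1) := one_le_div_sub_one hq hqm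
  rcases lt_or_ge c m with h | h
  · exact ⟨⟨c, by omega⟩, by simpa using hlt, by simp only; linarith,
      fun _ => by simp only; linarith⟩
  · have hmc : (m : ℝ) ≤ c := by exact_mod_cast h
    have hmul : q * y ≤ q * (m / (q - 1)) := by gcongr
    have hfix : q * ((m : ℝ) / (q - 1)) = m + m / (q - 1) := by
      have : q - 1 ≠ 0 := by linarith
      field_simp; ring
    exact ⟨Fin.last m, by rw [Fin.val_last]; linarith, by rw [Fin.val_last]; linarith,
      fun h => absurd h (lt_irrefl _)⟩

lemma val_shift_eq_of_remainder (hq : 1 < q) {x : ℕ → Fin (m + 1)} {r : ℕ → ℝ}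
    (hr : ∀ k, r (k + 1) = q * r k - ((x k : ℕ) : ℝ)) {C : ℝ} (hC : ∀ k, |r k| ≤ C) (k : ℕ) :
    val q (shift k x) = r k := by
  have hdiff (N : ℕ) : r k - val q (shift k x) =
      (r (k + N) - val q (shift (k + N) x)) / q ^ N := by
    induction N with
    | zero => simp
    | succ N ih =>
      rw [ih, ← Nat.add_assoc k N 1, hr, val_shift hq x (k + N), pow_succ]
      field_simp
      ring
  have habs : |r k - val q (shift k x)| ≤ 0 := by
    refine nonpos_of_forall_le_div_pow (C := C + m / (q - 1)) hq fun N => ?_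
    rw [hdiff N, abs_div, abs_of_pos (show 0 < q ^ N by positivity)]
    have h0 := val_nonneg hq (shift (k + N) x)
    have h1 := val_le hq (shift (k + N) x)
    have h2 := abs_le.1 (hC (k + N))
    gcongr
    exact abs_le.2 ⟨by linarith, by linarith⟩
  linarith [abs_nonpos_iff.1 habs]

lemma exists_quasiGreedy (hq : 1 < q) (hqm : q ≤ m + 1) {y : ℝ} (hy : 0 < y)
    (hym : y ≤ m / (q - 1)) :
    ∃ x : ℕ → Fin (m + 1), val q x = y ∧ InfNonzero x ∧
      ∀ k, x k < Fin.last m → val q (shift (k + 1) x) ≤ 1 := by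
  choose! f hfpos hfle hfone using fun (y : ℝ) (h : 0 < y ∧ y ≤ m / (q - 1)) =>
    exists_quasiGreedy_digit hq hqm h.1 h.2
  let r : ℕ → ℝ := fun k => Nat.rec y (fun _ z => q * z - ((f z : ℕ) : ℝ)) k
  have hr (k : ℕ) : 0 < r k ∧ r k ≤ m / (q - 1) := by
    induction k with
    | zero => exact ⟨hy, hym⟩
    | succ k ih => exact ⟨hfpos _ ih, hfle _ ih⟩
  have hval := val_shift_eq_of_remainder hq (x := fun k => f (r k)) (fun _ => rfl)
    fun k => (abs_of_pos (hr k).1).trans_le (hr k).2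
  refine ⟨fun k => f (r k), ?_, fun k => ?_, fun k hk => ?_⟩
  · rw [← shift_zero fun k => f (r k)]
    exact hval 0
  · by_contra! hzero
    have h0 : shift k (fun k => f (r k)) = fun _ => 0 := funext fun i => hzero (k + i) (by omega)
    have hk := hval k
    rw [h0, val_zero] at hk
    exact (hr k).1.ne hk
  · rw [hval]
    exact hfone _ (hr k) hk

lemma exists_val_eq (hq : 1 < q) (hqm : q ≤ m + 1) {y : ℝ} (hy : 0 ≤ y)
    (hym : y ≤ m / (q - 1)) : ∃ x : ℕ → Fin (m + 1), val q x = y := by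
  rcases hy.eq_or_lt with rfl | hy
  · exact ⟨_, val_zero q⟩
  · exact (exists_quasiGreedy hq hqm hy hym).imp fun _ h => h.1

lemma val_le_val_of_lt (hq : 1 < q) {x y : ℕ → Fin (m + 1)}
    (hx : ∀ k, x k < Fin.last m → val q (shift (k + 1) x) ≤ 1) (hxy : toLex x < toLex y) :
    val q x ≤ val q y := by
  obtain ⟨k, hk, hlt⟩ := toLex_lt_iff.1 hxy
  refine le_trans (le_add_of_nonneg_right ?_) (val_add_le_val hq hk hlt)
  have htail := hx k (hlt.trans_le (Fin.le_last _))
  exact div_nonneg (by linarith [val_nonneg hq (shift (k + 1) y)]) (by positivity)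

lemma val_lt_val_of_lt (hq : 1 < q) {x y : ℕ → Fin (m + 1)}
    (hx : ∀ k, x k < Fin.last m → val q (shift (k + 1) x) ≤ 1) (hxy : toLex x < toLex y)
    (hy : InfNonzero y) : val q x < val q y := by
  obtain ⟨k, hk, hlt⟩ := toLex_lt_iff.1 hxy
  refine lt_of_lt_of_le (lt_add_of_pos_right _ ?_) (val_add_le_val hq hk hlt)
  have htail := hx k (hlt.trans_le (Fin.le_last _))
  exact div_pos (by linarith [(hy.shift (k + 1)).val_pos hq]) (by positivity)

lemma isQuasiGreedy_iff (hq : 1 < q) (hqm : q ≤ m + 1) {y : ℝ} (hy : 0 < y)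
    {α : ℕ → Fin (m + 1)} :
    IsQuasiGreedy q y α ↔ val q α = y ∧ InfNonzero α ∧
      ∀ k, α k < Fin.last m → val q (shift (k + 1) α) ≤ 1 := by
  constructor
  · rintro ⟨hα, hinf, hmax⟩
    rw [isExpansion_iff hq] at hα
    obtain ⟨k₀, hk₀⟩ : ∃ k, α k ≠ 0 := by
      by_contra! hzero
      rw [show α = fun _ => 0 from funext hzero, val_zero] at hα
      exact hy.ne hα
    refine ⟨hα, hinf.infNonzero hk₀, fun k hk => ?_⟩
    by_contra! hgt
    have hle := val_le hq (shift (k + 1) α)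
    obtain ⟨t, ht, htinf, -⟩ := exists_quasiGreedy hq hqm
      (y := val q (shift (k + 1) α) - 1) (by linarith) (by linarith)
    obtain ⟨d, hd, hlt, hdt⟩ := exists_val_eq_of_lt_last hq hk ht
    refine (hmax d ((isExpansion_iff hq).2 (hd.trans hα)) ?_).not_gt hlt
    exact (InfNonzero.of_shift (hdt ▸ htinf)).isInfinite
  · rintro ⟨hα, hinf, htail⟩
    refine ⟨(isExpansion_iff hq).2 hα, hinf.isInfinite, fun d hd hdinf => ?_⟩
    rw [isExpansion_iff hq] at hd
    by_contra! hlt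
    obtain ⟨k, -, hklt⟩ := toLex_lt_iff.1 hlt
    have := val_lt_val_of_lt hq htail hlt (hdinf.infNonzero ((Fin.zero_le _).trans_lt hklt).ne')
    linarith

lemma exists_isQuasiGreedy (hq : 1 < q) (hqm : q ≤ m + 1) :
    ∃ α : ℕ → Fin (m + 1), IsQuasiGreedy q 1 α :=
  (exists_quasiGreedy hq hqm one_pos (one_le_div_sub_one hq hqm)).imp fun _ =>
    (isQuasiGreedy_iff hq hqm one_pos).2

/-- Comparing a tail with `α` up to the first difference divides any bound for the excess of the
values of such tails over `1` by `q`; iterating this leaves no excess. -/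
lemma val_shift_le_one (hq : 1 < q) {α d : ℕ → Fin (m + 1)} (hα : val q α = 1)
    (hd : ∀ n, d n < Fin.last m → toLex (shift (n + 1) d) ≤ toLex α) {n : ℕ}
    (hn : d n < Fin.last m) : val q (shift (n + 1) d) ≤ 1 := by
  have hstep {C : ℝ} (hC : 0 ≤ C)
      (h : ∀ n, d n < Fin.last m → val q (shift (n + 1) d) - 1 ≤ C) (n : ℕ)
      (hn : d n < Fin.last m) : val q (shift (n + 1) d) - 1 ≤ C / q := by
    rcases (hd n hn).eq_or_lt with heq | hlt
    · rw [toLex.injective heq, hα, sub_self]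
      positivity
    obtain ⟨k, hk, hlt⟩ := toLex_lt_iff.1 hlt
    have hle := val_add_le_val hq hk hlt
    rw [hα, shift_shift, ← Nat.add_assoc (n + 1) k 1] at hle
    have htail := h (n + 1 + k) (hlt.trans_le (Fin.le_last _))
    have hnonneg := val_nonneg hq (shift (k + 1) α)
    have hpow : C / q ^ (k + 1) ≤ C / q :=
      div_le_div_of_nonneg_left hC (by linarith) (le_self_pow₀ hq.le k.succ_ne_zero)
    have hdiv : -(C / q ^ (k + 1)) ≤ (1 + val q (shift (k + 1) α) -
        val q (shift (n + 1 + k + 1) d)) / q ^ (k + 1) := by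
      rw [← neg_div]
      exact div_le_div_of_nonneg_right (by linarith) (by positivity)
    linarith
  have hC : 0 ≤ (m : ℝ) / (q - 1) := div_nonneg (by positivity) (by linarith)
  have hpow (N : ℕ) : ∀ n, d n < Fin.last m →
      val q (shift (n + 1) d) - 1 ≤ (m / (q - 1)) / q ^ N := by
    induction N with
    | zero =>
      intro n _
      rw [pow_zero, div_one]
      linarith [val_le hq (shift (n + 1) d)]
    | succ N ih =>
      rw [pow_succ, ← div_div]
      exact hstep (div_nonneg hC (by positivity)) ih
  linarith [nonpos_of_forall_le_div_pow hq fun N => hpow N n hn]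

lemma val_shift_lt_one (hq : 1 < q) {α d : ℕ → Fin (m + 1)} (hα : val q α = 1)
    (hinf : InfNonzero α) (hd : ∀ n, d n < Fin.last m → toLex (shift (n + 1) d) < toLex α)
    {n : ℕ} (hn : d n < Fin.last m) : val q (shift (n + 1) d) < 1 :=
  hα ▸ val_lt_val_of_lt hq
    (fun k hk => by
      rw [shift_shift]
      exact val_shift_le_one hq hα (fun n hn => (hd n hn).le) hk)
    (hd n hn) hinf

lemma isQuasiGreedy_of_shift_le (hq : 1 < q) {α : ℕ → Fin (m + 1)} (hα : val q α = 1)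
    (hinf : InfNonzero α) (h : ∀ k, toLex (shift k α) ≤ toLex α) : IsQuasiGreedy q 1 α :=
  (isQuasiGreedy_iff hq (le_add_one_of_val_eq_one hq hα) one_pos).2
    ⟨hα, hinf, fun _ hk => val_shift_le_one hq hα (fun _ _ => h _) hk⟩

namespace IsQuasiGreedy

variable {α : ℕ → Fin (m + 1)}

lemma val_eq (h : IsQuasiGreedy q 1 α) : val q α = 1 := h.1.tsum_eq

lemma infNonzero (h : IsQuasiGreedy q 1 α) (hq : 1 < q) : InfNonzero α :=
  ((isQuasiGreedy_iff hq (le_add_one_of_val_eq_one hq h.val_eq) one_pos).1 h).2.1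

lemma val_shift_le (h : IsQuasiGreedy q 1 α) (hq : 1 < q) {k : ℕ} (hk : α k < Fin.last m) :
    val q (shift (k + 1) α) ≤ 1 :=
  ((isQuasiGreedy_iff hq (le_add_one_of_val_eq_one hq h.val_eq) one_pos).1 h).2.2 k hk

lemma one_le_val (h : IsQuasiGreedy q 1 α) (hq : 1 < q) {x : ℕ → Fin (m + 1)}
    (hx : toLex α < toLex x) : 1 ≤ val q x :=
  h.val_eq ▸ val_le_val_of_lt hq (fun _ hk => h.val_shift_le hq hk) hx

lemma one_lt_val (h : IsQuasiGreedy q 1 α) (hq : 1 < q) {x : ℕ → Fin (m + 1)}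
    (hx : toLex α < toLex x) (hinf : InfNonzero x) : 1 < val q x :=
  h.val_eq ▸ val_lt_val_of_lt hq (fun _ hk => h.val_shift_le hq hk) hx hinf

lemma shift_succ_le_of_lt_last (h : IsQuasiGreedy q 1 α) (hq : 1 < q) {k : ℕ}
    (hk : α k < Fin.last m) : toLex (shift (k + 1) α) ≤ toLex α :=
  not_lt.1 fun hlt =>
    (h.one_lt_val hq hlt ((h.infNonzero hq).shift _)).not_ge (h.val_shift_le hq hk)

lemma shift_one_le (h : IsQuasiGreedy q 1 α) (hq : 1 < q) : toLex (shift 1 α) ≤ toLex α := by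
  rcases (Fin.le_last (α 0)).lt_or_eq with h0 | h0
  · exact h.shift_succ_le_of_lt_last hq h0
  · refine not_lt.1 fun hlt => ?_
    obtain ⟨l, hl, hlt⟩ := toLex_lt_iff.1 hlt
    have hlast (j : ℕ) (hj : j ≤ l) : α j = Fin.last m := by
      induction j with
      | zero => exact h0
      | succ j ih => rw [← ih (by omega), hl j (by omega), shift_apply, Nat.add_comm 1]
    exact (hlt.trans_le (Fin.le_last _)).ne (hlast l le_rfl)

lemma shift_le (h : IsQuasiGreedy q 1 α) (hq : 1 < q) (k : ℕ) : toLex (shift k α) ≤ toLex α := by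
  induction k with
  | zero => rw [shift_zero]
  | succ k ih =>
    rcases (Fin.le_last (α k)).lt_or_eq with hk | hk
    · exact h.shift_succ_le_of_lt_last hq hk
    · have h0 : α 0 = Fin.last m :=
        le_antisymm (Fin.le_last _) (hk ▸ Pi.apply_le_of_toLex ih (i := 0) (by simp))
      have hag : AgreeOn 1 α (shift k α) := fun j hj => by simp [Nat.lt_one_iff.1 hj, h0, hk]
      have hshift : toLex (shift 1 (shift k α)) ≤ toLex (shift 1 α) :=
        not_lt.1 fun hlt => ih.not_gt (hag.shift_lt_shift_iff.1 hlt)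
      rw [shift_shift] at hshift
      exact hshift.trans (h.shift_one_le hq)

end IsQuasiGreedy

end QuasiGreedy

/-! ### Unique expansions -/

section Unique

variable {q : ℝ} {α b : ℕ → Fin (m + 1)}

lemma mem_univoqueSeqs_iff_forall (hq : 1 < q) :
    b ∈ univoqueSeqs m q ↔ ∀ d, val q d = val q b → d = b := by
  constructor
  · rintro ⟨x, ⟨-, c, -, hu⟩, hb⟩ d hd
    rw [isExpansion_iff hq] at hb
    rw [hu d ((isExpansion_iff hq).2 (hd.trans hb)), hu b ((isExpansion_iff hq).2 hb)]
  · intro h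
    have hb : IsExpansion q (val q b) b := (isExpansion_iff hq).2 rfl
    exact ⟨val q b, ⟨⟨val_nonneg hq b, val_le hq b⟩, b, hb,
      fun d hd => h d ((isExpansion_iff hq).1 hd)⟩, hb⟩

lemma reflectSeq_mem_univoqueSeqs_iff (hq : 1 < q) :
    reflectSeq b ∈ univoqueSeqs m q ↔ b ∈ univoqueSeqs m q := by
  have himp (b : ℕ → Fin (m + 1)) (hb : b ∈ univoqueSeqs m q) :
      reflectSeq b ∈ univoqueSeqs m q := by
    rw [mem_univoqueSeqs_iff_forall hq] at hb ⊢
    intro d hd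
    rw [← hb (reflectSeq d) (by rw [val_reflectSeq hq, hd, val_reflectSeq hq]; ring),
      reflectSeq_reflectSeq]
  exact ⟨fun h => reflectSeq_reflectSeq b ▸ himp _ h, himp b⟩

/-- Every tail of `b` which follows a digit less than `m` is lexicographically smaller than `α`.
For `α = α(q)`, this condition on `b` and on its reflection characterizes the unique
`q`-expansions. -/
def UpperCond (α b : ℕ → Fin (m + 1)) : Prop :=
  ∀ n, b n < Fin.last m → toLex (shift (n + 1) b) < toLex α

lemma upperCond_of_mem (hq : 1 < q) (hα : IsQuasiGreedy q 1 α) (hb : b ∈ univoqueSeqs m q) :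
    UpperCond α b := by
  intro n hn
  rw [mem_univoqueSeqs_iff_forall hq] at hb
  have hlt : val q (shift (n + 1) b) < 1 := by
    by_contra! hge
    obtain ⟨t, ht⟩ := exists_val_eq hq (le_add_one_of_val_eq_one hq hα.val_eq)
      (y := val q (shift (n + 1) b) - 1) (by linarith) (by linarith [val_le hq (shift (n + 1) b)])
    obtain ⟨d, hd, hlt, -⟩ := exists_val_eq_of_lt_last hq hn ht
    exact hlt.ne' (congrArg toLex (hb d hd))
  refine not_le.1 fun hle => hlt.not_ge ?_
  rcases hle.eq_or_lt with heq | h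
  · rw [← toLex.injective heq, hα.val_eq]
  · exact hα.one_le_val hq h

lemma UpperCond.not_lt_of_val_eq (h : UpperCond α b) (hq : 1 < q) (hα : IsQuasiGreedy q 1 α)
    {d : ℕ → Fin (m + 1)} (hd : val q d = val q b) : ¬ toLex b < toLex d := by
  intro hlt
  obtain ⟨k, hk, hlt⟩ := toLex_lt_iff.1 hlt
  have htail := val_shift_lt_one hq hα.val_eq (hα.infNonzero hq) h (hlt.trans_le (Fin.le_last _))
  have hle := val_add_le_val hq hk hlt
  have : 0 < (1 + val q (shift (k + 1) d) - val q (shift (k + 1) b)) / q ^ (k + 1) :=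
    div_pos (by linarith [val_nonneg hq (shift (k + 1) d)]) (by positivity)
  linarith

lemma mem_univoqueSeqs_iff (hq : 1 < q) (hα : IsQuasiGreedy q 1 α) :
    b ∈ univoqueSeqs m q ↔ UpperCond α b ∧ UpperCond α (reflectSeq b) := by
  refine ⟨fun h => ⟨upperCond_of_mem hq hα h,
    upperCond_of_mem hq hα ((reflectSeq_mem_univoqueSeqs_iff hq).2 h)⟩, fun ⟨h, h'⟩ => ?_⟩
  refine (mem_univoqueSeqs_iff_forall hq).2 fun d hd => toLex.injective (le_antisymm ?_ ?_)
  · exact not_lt.1 (h.not_lt_of_val_eq hq hα hd)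
  · refine not_lt.1 fun hlt => h'.not_lt_of_val_eq hq hα (d := reflectSeq d) ?_
      (reflectSeq_lt_reflectSeq_iff.2 hlt)
    rw [val_reflectSeq hq, hd, val_reflectSeq hq]

lemma shift_lt_of_forall_lt (hα : toLex (shift 1 α) ≤ toLex α) {l j : ℕ}
    (h : ∀ n < l, b n < Fin.last m → toLex (shift (n + 1) b) < toLex α) (hj : j < l)
    (hbj : b j < Fin.last m) : toLex (shift l b) < toLex α := by
  induction l with
  | zero => omega
  | succ l ih =>
    rcases (Fin.le_last (b l)).lt_or_eq with hl | hl
    · exact h l (by omega) hl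
    · have hjl : j ≠ l := fun hjl => hbj.ne (hjl ▸ hl)
      have hlt := ih (fun n hn => h n (by omega)) (by omega)
      have h0 : α 0 = Fin.last m :=
        le_antisymm (Fin.le_last _) (hl ▸ Pi.apply_le_of_toLex hlt.le (i := 0) (by simp))
      have hag : AgreeOn 1 (shift l b) α := fun i hi => by simp [Nat.lt_one_iff.1 hi, h0, hl]
      rw [← hag.shift_lt_shift_iff, shift_shift] at hlt
      exact hlt.trans_le hα

end Unique

/-! ### Dependence on the base -/

section Base

variable {q : ℝ} {α : ℕ → Fin (m + 1)}

lemma continuousOn_val {p : ℝ} (hp : 1 < p) (x : ℕ → Fin (m + 1)) :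
    ContinuousOn (fun q => val q x) (Set.Ici p) := by
  refine continuousOn_tsum (u := fun i => (m : ℝ) / p ^ (i + 1)) (fun i => ?_)
    (hasSum_div_pow_succ hp m).summable fun i q hq => ?_
  · refine ContinuousOn.div continuousOn_const (continuousOn_id.pow _) fun q (hq : p ≤ q) => ?_
    exact pow_ne_zero _ (show q ≠ 0 by linarith)
  · have hpq : p ≤ q := hq
    have hq0 : 0 < q := by linarith
    have := digit_le (x i)
    rw [Real.norm_of_nonneg (by positivity)]
    gcongr

namespace IsQuasiGreedy

lemma lt_of_base_lt {r : ℝ} (hq : 1 < q) (hqr : q < r) {β : ℕ → Fin (m + 1)}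
    (hα : IsQuasiGreedy q 1 α) (hβ : IsQuasiGreedy r 1 β) : toLex α < toLex β := by
  obtain ⟨k, -, hk⟩ := hα.infNonzero hq 0
  have hval := val_lt_val_of_base_lt hq hqr hk
  rw [hα.val_eq] at hval
  refine not_le.1 fun hle => hval.not_ge ?_
  rcases hle.eq_or_lt with heq | hlt
  · rw [← toLex.injective heq, hβ.val_eq]
  · exact hβ.one_le_val (hq.trans hqr) hlt

/-- The first `N` digits of `α`, continued by `0^∞`, have a value less than `1` in base `q`, and
hence in all bases near `q`. -/
lemma eventually_agreeOn (hα : IsQuasiGreedy q 1 α) (hq : 1 < q) (N : ℕ) :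
    ∀ᶠ r in nhds q, ∀ β : ℕ → Fin (m + 1), r < q → IsQuasiGreedy r 1 β → AgreeOn N β α := by
  set γ := appendSeq (initWord N α) (fun _ => 0)
  have hγα : AgreeOn N γ α := agreeOn_appendSeq_initWord _ _ _
  have hγ : val q γ < 1 := by
    have hsum := val_eq_sum_add hq α N
    have hsum' := val_eq_sum_add hq γ N
    rw [hα.val_eq] at hsum
    rw [show shift N γ = fun _ => 0 from shift_appendSeq_initWord _ _ _, val_zero, zero_div,
      Finset.sum_congr rfl fun i hi => by rw [hγα i (Finset.mem_range.1 hi)]] at hsum'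
    have : 0 < val q (shift N α) / q ^ N :=
      div_pos (((hα.infNonzero hq).shift N).val_pos hq) (by positivity)
    linarith
  obtain ⟨p, hp, hpq⟩ := exists_between hq
  have hcont : ContinuousAt (fun r => val r γ) q :=
    (continuousOn_val hp γ).continuousAt (Ici_mem_nhds hpq)
  filter_upwards [hcont.eventually_lt continuousAt_const hγ, lt_mem_nhds hq] with r hrγ hr β hrq hβ
  refine (prefixLT_or_agreeOn N (hβ.lt_of_base_lt hr hrq hα).le).resolve_left fun hlt => ?_
  exact hrγ.not_ge (hβ.one_le_val hr (hlt.congr (AgreeOn.refl N β) hγα.symm).lt)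

end IsQuasiGreedy

end Base

/-! ### Admissible words and period doubling -/

/-- The prefix `w` of length `L` of `c` is admissible: every nonempty suffix of `w` is at most the
prefix of `w` of the same length, and larger than the reflection of this prefix. -/
structure Adm (L : ℕ) (c : ℕ → Fin (m + 1)) : Prop where
  upper : ∀ i, ¬ PrefixLT (L - i) c (shift i c)
  lower : ∀ i < L, PrefixLT (L - i) (reflectSeq c) (shift i c)

/-- The prefix of length `2 L` of `c` is `w w̄⁺`, where `w` is its prefix of length `L`. -/
def Doubles (L : ℕ) (c : ℕ → Fin (m + 1)) : Prop := PrefixSucc L (reflectSeq c) (shift L c)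

section Adm

variable {L : ℕ} {c y : ℕ → Fin (m + 1)}

lemma Adm.prefixLT_shift (h : Adm L c) (hy : AgreeOn L y c)
    (hy' : AgreeOn (L - 1) (shift L y) (reflectSeq c)) {i : ℕ} (hi : 0 < i) (hiL : i < L) :
    PrefixLT L (shift i y) c := by
  have hyi : AgreeOn (L - i) (shift i y) (shift i c) := (hy.mono (by omega)).shift
  rcases prefixLT_or_agreeOn_of_not (h.upper i) with hlt | hag
  · exact (hlt.congr hyi.symm (AgreeOn.refl _ c)).mono (by omega)
  · have hlower := h.lower (L - i) (by omega)
    rw [show L - (L - i) = i by omega] at hlower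
    have htail : AgreeOn i (reflectSeq c) (shift (L - i) (shift i y)) := by
      rw [shift_shift, show i + (L - i) = L by omega]
      exact (hy'.mono (by omega)).symm
    exact ((hyi.trans hag).prefixLT_add (hlower.congr htail (AgreeOn.refl _ _))).mono (by omega)

lemma Adm.reflectSeq_lt_shift (h : Adm L c) (hy : AgreeOn L y c) {i : ℕ} (hiL : i < L) :
    toLex (reflectSeq c) < toLex (shift i y) :=
  ((h.lower i hiL).congr (AgreeOn.refl _ _) (hy.symm.mono (by omega)).shift).lt

lemma Adm.doubles (h : Adm L c) (hd : Doubles L c) : Adm (2 * L) c := by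
  have hsucc (i : ℕ) (hi : i < L) :
      PrefixSucc (2 * L - (L + i)) (shift i (reflectSeq c)) (shift (L + i) c) := by
    rw [← shift_shift, show 2 * L - (L + i) = L - i by omega]
    exact PrefixSucc.shift hd hi
  have hlen (i : ℕ) : L - i = 2 * L - (L + i) := by omega
  constructor
  · intro i
    rcases lt_or_ge i L with hiL | hiL
    · rcases Nat.eq_zero_or_pos i with rfl | hi
      · rw [shift_zero]
        exact (AgreeOn.refl _ c).not_prefixLT
      · have hlt := h.prefixLT_shift (AgreeOn.refl L c) hd.agreeOn.symm hi hiL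
        exact fun hlt' => hlt'.lt.asymm hlt.lt
    · obtain ⟨i, rfl⟩ := Nat.exists_eq_add_of_le hiL
      rcases lt_or_ge i L with hi | hi
      · refine (hsucc i hi).not_prefixLT ?_
        rw [shift_reflectSeq, ← prefixLT_reflectSeq_iff, reflectSeq_reflectSeq, ← hlen]
        exact h.lower i hi
      · rintro ⟨k, hk, -⟩
        omega
  · intro i hi
    rcases lt_or_ge i L with hiL | hiL
    · exact (h.lower i hiL).mono (by omega)
    · obtain ⟨i, rfl⟩ := Nat.exists_eq_add_of_le hiL
      refine PrefixLT.trans_of_not ?_ (hsucc i (by omega)).prefixLT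
      rw [shift_reflectSeq, prefixLT_reflectSeq_iff, ← hlen]
      exact h.upper i

lemma Doubles.next_block (hd : Doubles L c) (hy : AgreeOn L y c) (hyc : toLex y < toLex c)
    (hc : toLex (reflectSeq c) < toLex (shift L y)) :
    AgreeOn L (shift L y) (reflectSeq c) ∨ AgreeOn (2 * L) y c := by
  rcases hd.agreeOn_or_agreeOn hc.le (hy.shift_lt_shift_iff.2 hyc).le with h | h
  · exact Or.inl h
  · exact Or.inr (two_mul L ▸ hy.add h)

lemma Doubles.next_block_reflectSeq (hd : Doubles L c) (hy : AgreeOn L y (reflectSeq c))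
    (hyc : toLex (reflectSeq c) < toLex y) (hc : toLex (shift L y) < toLex c) :
    AgreeOn L (shift L y) c ∨ AgreeOn (2 * L) y (reflectSeq c) := by
  have h := hd.next_block (y := reflectSeq y) (by rw [← agreeOn_reflectSeq_iff]; simpa using hy)
    (reflectSeq_lt_comm.1 hyc) (reflectSeq_lt_reflectSeq_iff.2 hc)
  rw [shift_reflectSeq, agreeOn_reflectSeq_iff, ← agreeOn_reflectSeq_iff (x := reflectSeq y)] at h
  simpa using h

end Adm

/-- The sequence `x` is periodic with the block `c₀⁻` of length `n`, the word `c₀` is admissible,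
and the words `c_ℓ` generated by it are the prefixes of length `n 2^ℓ` of `c`. -/
structure PeriodDoubling (n : ℕ) (x c : ℕ → Fin (m + 1)) : Prop where
  periodic : shift n x = x
  succ : PrefixSucc n x c
  adm : Adm n c
  doubles : ∀ l, Doubles (n * 2 ^ l) c

namespace PeriodDoubling

variable {n : ℕ} {x c y e : ℕ → Fin (m + 1)}

lemma adm_pow (h : PeriodDoubling n x c) (l : ℕ) : Adm (n * 2 ^ l) c := by
  induction l with
  | zero => simpa using h.adm
  | succ l ih =>
    rw [show n * 2 ^ (l + 1) = 2 * (n * 2 ^ l) by ring]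
    exact ih.doubles (h.doubles l)

lemma lt_length (h : PeriodDoubling n x c) (l : ℕ) : l < n * 2 ^ l :=
  Nat.lt_two_pow_self.trans_le (Nat.le_mul_of_pos_left _ h.succ.pos)

lemma shift_lt (h : PeriodDoubling n x c) {k : ℕ} (hk : 0 < k) :
    toLex (shift k c) < toLex c :=
  ((h.adm_pow k).prefixLT_shift (AgreeOn.refl _ c) (h.doubles k).agreeOn.symm hk
    (h.lt_length k)).lt

lemma reflectSeq_lt_shift (h : PeriodDoubling n x c) (k : ℕ) :
    toLex (reflectSeq c) < toLex (shift k c) :=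
  (h.adm_pow k).reflectSeq_lt_shift (AgreeOn.refl _ c) (h.lt_length k)

lemma lt (h : PeriodDoubling n x c) : toLex x < toLex c := h.succ.prefixLT.lt

lemma exists_max_agreeOn (h : PeriodDoubling n x c) {k : ℕ} (hk : AgreeOn (n * 2 ^ k) y c)
    (hne : y ≠ c) :
    ∃ l, k ≤ l ∧ AgreeOn (n * 2 ^ l) y c ∧ ¬ AgreeOn (2 * (n * 2 ^ l)) y c := by
  by_contra! hcon
  have hall (N : ℕ) : AgreeOn (n * 2 ^ (k + N)) y c := by
    induction N with
    | zero => exact hk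
    | succ N ih =>
      rw [show n * 2 ^ (k + (N + 1)) = 2 * (n * 2 ^ (k + N)) by ring]
      exact hcon _ (by omega) ih
  exact hne (funext fun i => hall i i ((Nat.le_add_left i k).trans_lt (h.lt_length _)))

/-- The hypotheses on `e` say that `e` is the expansion of `1` in a univoque base. -/
lemma le_of_lt (h : PeriodDoubling n x c) (hxe : toLex x < toLex e)
    (hupper : ∀ k, toLex (shift k e) ≤ toLex e)
    (hlower : ∀ k, 0 < k → toLex (reflectSeq e) < toLex (shift k e)) : toLex c ≤ toLex e := by
  refine not_lt.1 fun hec => ?_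
  rcases h.succ.agreeOn_or_agreeOn hxe.le hec.le with hag | hag
  · obtain ⟨k, hk, hlt⟩ := toLex_lt_iff.1 hxe
    have hnk : n ≤ k := not_lt.1 fun hkn => hlt.ne (hag k hkn).symm
    obtain ⟨j, rfl⟩ := Nat.exists_eq_add_of_le hnk
    have hx (i : ℕ) : x (n + i) = x i := congrFun h.periodic i
    have hj : j < n + j := Nat.lt_add_of_pos_left h.succ.pos
    refine (hupper n).not_gt (toLex_lt_iff.2 ⟨j, fun i hi => ?_, ?_⟩)
    · rw [shift_apply, ← hk i (hi.trans hj), ← hk (n + i) (by omega), hx]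
    · rwa [shift_apply, ← hk j hj, ← hx j]
  · have hne : e ≠ c := by
      rintro rfl
      exact lt_irrefl _ hec
    obtain ⟨l, -, hl, hl'⟩ := h.exists_max_agreeOn (k := 0) (by simpa using hag) hne
    set L := n * 2 ^ l
    have hL : 0 < L := (Nat.zero_le l).trans_lt (h.lt_length l)
    have hnext : AgreeOn L (shift L e) (reflectSeq e) :=
      (((h.doubles l).next_block hl hec
        ((reflectSeq_lt_reflectSeq_iff.2 hec).trans (hlower L hL))).resolve_right hl').trans
        (agreeOn_reflectSeq_iff.2 hl.symm)
    obtain ⟨k, hk, hlt⟩ := toLex_lt_iff.1 (hlower L hL)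
    have hLk : L ≤ k := not_lt.1 fun hkL => hlt.ne (hnext k hkL).symm
    obtain ⟨j, rfl⟩ := Nat.exists_eq_add_of_le hLk
    have he (i : ℕ) (hi : i < L + j) : e (L + i) = (e i).rev := (hk i hi).symm
    have hj : j < L + j := Nat.lt_add_of_pos_left hL
    refine (hupper (L + L)).not_gt (toLex_lt_iff.2 ⟨j, fun i hi => ?_, ?_⟩)
    · rw [shift_apply, add_assoc, ← shift_apply (x := e), ← hk (L + i) (by omega), reflectSeq_apply,
        he i (hi.trans hj), Fin.rev_rev]
    · rw [reflectSeq_apply, he j hj, Fin.rev_rev] at hlt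
      rwa [shift_apply, add_assoc]

end PeriodDoubling

/-! ### The words `c_ℓ` -/

lemma PrefixSucc.last_pos {N : ℕ} {u v : ℕ → Fin (m + 1)} (h : PrefixSucc N u v) :
    0 < v (N - 1) := by
  rw [Fin.lt_def, h.last]
  exact Nat.succ_pos _

lemma prefixSucc_of_incrLast {N : ℕ} {u v : ℕ → Fin (m + 1)} (hN : 0 < N)
    (hu : u (N - 1) < Fin.last m) (h : incrLast (initWord N u) = initWord N v) :
    PrefixSucc N u v := by
  obtain ⟨K, rfl⟩ := Nat.exists_eq_add_one.2 hN
  rw [initWord_succ, incrLast_concat, initWord_succ] at h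
  have hsplit := List.append_inj' h rfl
  have hlast : u K + 1 = v K := by simpa using hsplit.2
  refine ⟨hN, initWord_eq_initWord_iff.1 hsplit.1, ?_⟩
  rw [Nat.add_sub_cancel] at hu ⊢
  rw [← hlast, Fin.val_add_one_of_lt hu]

lemma length_incrLast (w : List (Fin (m + 1))) : (incrLast w).length = w.length := by
  rcases w.eq_nil_or_concat' with rfl | ⟨v, d, rfl⟩
  · rfl
  · simp [incrLast_concat]

section BlockWord

variable (a : List (Fin (m + 1)))

lemma length_blockWord (l : ℕ) : (blockWord a l).length = a.length * 2 ^ l := by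
  induction l with
  | zero => simp [blockWord, length_incrLast]
  | succ l ih =>
    rw [blockWord, List.length_append, length_incrLast, reflect, List.length_map, ih]
    ring

lemma blockWord_prefix_blockWord {k l : ℕ} (hkl : k ≤ l) : blockWord a k <+: blockWord a l := by
  induction l, hkl using Nat.le_induction with
  | base => exact List.prefix_rfl
  | succ l _ ih => exact ih.trans (List.prefix_append _ _)

/-- The limit of the words `c_ℓ`. -/
def limitSeq : ℕ → Fin (m + 1) := fun j => (blockWord a j).getD j 0

lemma blockWord_eq_initWord (l : ℕ) :
    blockWord a l = initWord (a.length * 2 ^ l) (limitSeq a) := by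
  refine List.ext_getElem (by simp [length_blockWord]) fun i hi hi' => ?_
  have ha : 0 < a.length := by
    rw [length_initWord] at hi'
    exact pos_of_mul_pos_left (Nat.zero_lt_of_lt hi') (Nat.zero_le _)
  have hii : i < (blockWord a i).length := by
    rw [length_blockWord]
    exact Nat.lt_two_pow_self.trans_le (Nat.le_mul_of_pos_left _ ha)
  have hget : (blockWord a l)[i] = (blockWord a i)[i] := by
    rcases le_total l i with hle | hle
    · exact (blockWord_prefix_blockWord a hle).getElem hi
    · exact ((blockWord_prefix_blockWord a hle).getElem hii).symm
  simp [initWord, limitSeq, hget, hii]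

variable {a}

lemma prefixSucc_limitSeq (ha : a ≠ []) (hlast : periodicSeq a (a.length - 1) < Fin.last m) :
    PrefixSucc a.length (periodicSeq a) (limitSeq a) := by
  refine prefixSucc_of_incrLast (List.length_pos_iff.2 ha) hlast ?_
  rw [initWord_periodicSeq]
  have hword := blockWord_eq_initWord a 0
  rwa [pow_zero, mul_one, blockWord] at hword

lemma doubles_limitSeq_of_pos {l : ℕ} (hL : 0 < a.length * 2 ^ l)
    (hpos : 0 < limitSeq a (a.length * 2 ^ l - 1)) :
    Doubles (a.length * 2 ^ l) (limitSeq a) := by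
  refine prefixSucc_of_incrLast hL ?_ ?_
  · simpa using Fin.rev_lt_rev.2 hpos
  · have hword := blockWord_eq_initWord a (l + 1)
    rw [pow_succ, ← mul_assoc, mul_two, initWord_add, blockWord, blockWord_eq_initWord a l,
      reflect_initWord] at hword
    exact List.append_cancel_left hword

lemma doubles_limitSeq (ha : a ≠ []) (hlast : periodicSeq a (a.length - 1) < Fin.last m) (l : ℕ) :
    Doubles (a.length * 2 ^ l) (limitSeq a) := by
  have hL (l : ℕ) : 0 < a.length * 2 ^ l := by
    have := List.length_pos_iff.2 ha
    positivity
  induction l with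
  | zero =>
    refine doubles_limitSeq_of_pos (hL 0) ?_
    simpa using (prefixSucc_limitSeq ha hlast).last_pos
  | succ l ih =>
    refine doubles_limitSeq_of_pos (hL (l + 1)) ?_
    have hpos : 0 < shift (a.length * 2 ^ l) (limitSeq a) (a.length * 2 ^ l - 1) := ih.last_pos
    rwa [shift_apply, ← Nat.add_sub_assoc (hL l), ← mul_two, mul_assoc, ← pow_succ] at hpos

end BlockWord

lemma adm_of_periodic {n : ℕ} {x c : ℕ → Fin (m + 1)} (hxc : PrefixSucc n x c)
    (hper : shift n x = x) (hmin : ∀ i, 0 < i → i < n → shift i x ≠ x)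
    (hupper : ∀ k, toLex (shift k x) ≤ toLex x)
    (hlower : ∀ k, toLex (reflectSeq x) < toLex (shift k x)) : Adm n c := by
  constructor
  · intro i hlt
    obtain ⟨hi, hin⟩ : 0 < i ∧ i < n := by
      refine ⟨Nat.pos_of_ne_zero ?_, ?_⟩
      · rintro rfl
        exact (AgreeOn.refl _ c).not_prefixLT (shift_zero c ▸ hlt)
      · obtain ⟨k, hk, -⟩ := hlt
        omega
    have hix : toLex (shift i x) < toLex x :=
      (hupper i).lt_of_ne fun h => hmin i hi hin (toLex.injective h)
    have hpre : PrefixLT (n - i) (shift i x) x := by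
      refine (prefixLT_or_agreeOn _ hix.le).resolve_right fun hag => ?_
      have hlt' := hag.shift_lt_shift_iff.2 hix
      rw [shift_shift, Nat.add_sub_of_le hin.le, hper] at hlt'
      exact (hupper (n - i)).not_gt hlt'
    have hxc' : AgreeOn (n - i) x c := hxc.agreeOn.mono (by omega)
    exact (hxc.shift hin).not_prefixLT (hpre.congr (AgreeOn.refl _ _) hxc') hlt
  · intro i hi
    have hlt : toLex (reflectSeq c) < toLex (shift i x) :=
      hxc.reflectSeq.prefixLT.lt.trans (hlower i)
    exact PrefixLT.trans_of_not (fun h => h.lt.asymm hlt) (hxc.shift hi).prefixLT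

/-! ### Gaps in the set of univoque bases -/

namespace IsQuasiGreedy

variable {q : ℝ} {α : ℕ → Fin (m + 1)}

lemma val_shift_le_one (h : IsQuasiGreedy q 1 α) (hq : 1 < q) (k : ℕ) :
    val q (shift k α) ≤ 1 := by
  rcases (h.shift_le hq k).eq_or_lt with heq | hlt
  · rw [toLex.injective heq, h.val_eq]
  · rw [← h.val_eq]
    refine val_le_val_of_lt hq (fun j hj => ?_) hlt
    rw [shift_shift]
    exact h.val_shift_le hq hj

lemma le_head_add_one (h : IsQuasiGreedy q 1 α) (hq : 1 < q) : q ≤ (α 0 : ℕ) + 1 := by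
  have hval := val_shift hq α 0
  rw [shift_zero, h.val_eq, eq_div_iff (by linarith)] at hval
  linarith [h.val_shift_le_one hq (0 + 1)]

lemma lt_last_of_shift_eq (h : IsQuasiGreedy q 1 α) (hq : 1 < q) (hqm : q < m + 1) {k : ℕ}
    (hk : shift (k + 1) α = α) : α k < Fin.last m := by
  refine Fin.lt_last_iff_ne_last.2 fun hlast => ?_
  have hval := h.val_shift_le_one hq k
  rw [val_shift hq, hk, h.val_eq, hlast, Fin.val_last, div_le_one (by linarith)] at hval
  linarith

lemma mem_univoqueBases_iff (h : IsQuasiGreedy q 1 α) (hq : 1 < q) :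
    q ∈ univoqueBases m ↔ α ∈ univoqueSeqs m q := by
  refine ⟨fun hmem => ⟨1, hmem.2, h.1⟩, fun ⟨x, hx, hexp⟩ => ?_⟩
  rw [isExpansion_iff hq, h.val_eq] at hexp
  exact ⟨⟨hq, le_add_one_of_val_eq_one hq h.val_eq⟩, hexp ▸ hx⟩

lemma reflectSeq_lt_shift_of_mem (h : IsQuasiGreedy q 1 α) (hmem : q ∈ univoqueBases m) {k : ℕ}
    (hk : 0 < k) : toLex (reflectSeq α) < toLex (shift k α) := by
  have hq : 1 < q := hmem.1.1
  have hupper := ((mem_univoqueSeqs_iff hq h).1 ((h.mem_univoqueBases_iff hq).1 hmem)).2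
  have hhead : (0 : ℕ) < α 0 := by
    have := hq.trans_le (h.le_head_add_one hq)
    exact_mod_cast (lt_add_iff_pos_left 1).1 this
  refine reflectSeq_lt_comm.1
    (shift_lt_of_forall_lt (h.shift_one_le hq) (fun n _ => hupper n) hk ?_)
  rw [Fin.lt_def, reflectSeq_apply, Fin.val_rev, Fin.val_last]
  omega

end IsQuasiGreedy

/-- The open interval `(q, r)` contains no univoque bases, and its endpoints lie in the closure of
the set of univoque bases. -/
structure IsUnivoqueGap (m : ℕ) (q r : ℝ) : Prop where
  lt : q < r
  left_mem : q ∈ closure (univoqueBases m)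
  right_mem : r ∈ closure (univoqueBases m)
  notMem_Ioo : ∀ p ∈ univoqueBases m, p ∉ Set.Ioo q r

namespace IsComponentInterval

variable {S : Set ℝ} {q r : ℝ}

lemma lt (h : IsComponentInterval S q r) : q < r := by
  obtain ⟨x, hx, hC⟩ := h
  have hxI : x ∈ Set.Ioo q r := hC ▸ mem_connectedComponentIn hx
  exact hxI.1.trans hxI.2

lemma Ioo_subset (h : IsComponentInterval S q r) : Set.Ioo q r ⊆ S :=
  let ⟨_, _, hC⟩ := h; hC ▸ connectedComponentIn_subset _ _

lemma subset_Ioo_of_isPreconnected (h : IsComponentInterval S q r) {T : Set ℝ}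
    (hT : IsPreconnected T) (hqr : Set.Ioo q r ⊆ T) (hTS : T ⊆ S) : T ⊆ Set.Ioo q r := by
  obtain ⟨x, hx, hC⟩ := h
  rw [← hC]
  exact hT.subset_connectedComponentIn (hqr (hC ▸ mem_connectedComponentIn hx)) hTS

lemma left_notMem (h : IsComponentInterval S q r) : q ∉ S := fun hq =>
  have hsub : Set.Ico q r ⊆ S := by
    rw [← Set.Ioo_insert_left h.lt]
    exact Set.insert_subset hq h.Ioo_subset
  lt_irrefl q (h.subset_Ioo_of_isPreconnected isPreconnected_Ico Set.Ioo_subset_Ico_self hsub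
    (Set.left_mem_Ico.2 h.lt)).1

lemma right_notMem (h : IsComponentInterval S q r) : r ∉ S := fun hr =>
  have hsub : Set.Ioc q r ⊆ S := by
    rw [← Set.Ioo_insert_right h.lt]
    exact Set.insert_subset hr h.Ioo_subset
  lt_irrefl r (h.subset_Ioo_of_isPreconnected isPreconnected_Ioc Set.Ioo_subset_Ioc_self hsub
    (Set.right_mem_Ioc.2 h.lt)).2

lemma isUnivoqueGap (h : IsComponentInterval (complementSet m) q r)
    (hM : ((m / 2 + 1 : ℕ) : ℝ) < q) : IsUnivoqueGap m q r := by
  have hr : r ∈ Set.Icc q r := Set.right_mem_Icc.2 h.lt.le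
  have hrm : r ≤ m + 1 := by
    rw [← closure_Ioo h.lt.ne] at hr
    exact closure_minimal (fun y hy => (h.Ioo_subset hy).1.2) isClosed_Iic hr
  exact {
    lt := h.lt
    left_mem := by_contra fun hcl => h.left_notMem ⟨⟨hM, h.lt.le.trans hrm⟩, hcl⟩
    right_mem := by_contra fun hcl => h.right_notMem ⟨⟨hM.trans h.lt, hrm⟩, hcl⟩
    notMem_Ioo := fun p hp hpI => (h.Ioo_subset hpI).2 (subset_closure hp) }

end IsComponentInterval

lemma one_lt_of_half_add_one_lt {q : ℝ} (hM : ((m / 2 + 1 : ℕ) : ℝ) < q) : 1 < q :=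
  hM.trans_le' (by exact_mod_cast Nat.le_add_left 1 (m / 2))

namespace IsUnivoqueGap

variable {q r : ℝ} {α : ℕ → Fin (m + 1)}

lemma right_le (h : IsUnivoqueGap m q r) : r ≤ m + 1 :=
  closure_minimal (fun _ hp => hp.1.2) isClosed_Iic h.right_mem

lemma exists_agreeOn (h : IsUnivoqueGap m q r) (hq : 1 < q) (hα : IsQuasiGreedy q 1 α)
    (hmem : q ∉ univoqueBases m) (N : ℕ) :
    ∃ p ∈ univoqueBases m, p < q ∧ ∃ e, IsQuasiGreedy p 1 e ∧ AgreeOn N e α := by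
  obtain ⟨p, ⟨hag, hpr⟩, hpU⟩ := mem_closure_iff_nhds.1 h.left_mem _
    ((hα.eventually_agreeOn hq N).and (gt_mem_nhds h.lt))
  have hpq : p < q := (not_lt.1 fun hqp => h.notMem_Ioo p hpU ⟨hqp, hpr⟩).lt_of_ne fun heq =>
    hmem (heq ▸ hpU)
  obtain ⟨e, he⟩ := exists_isQuasiGreedy hpU.1.1 hpU.1.2
  exact ⟨p, hpU, hpq, e, he, hag e hpq he⟩

lemma reflectSeq_lt_shift_of_pos (h : IsUnivoqueGap m q r) (hq : 1 < q)
    (hα : IsQuasiGreedy q 1 α) {k : ℕ} (hk : 0 < k) :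
    toLex (reflectSeq α) < toLex (shift k α) := by
  by_cases hmem : q ∈ univoqueBases m
  · exact hα.reflectSeq_lt_shift_of_mem hmem hk
  refine not_le.1 fun hle => ?_
  rcases hle.eq_or_lt with heq | hlt
  · obtain ⟨p, hpU, hpq, e, he, hag⟩ := h.exists_agreeOn hq hα hmem k
    have heα := he.lt_of_base_lt hpU.1.1 hpq hα
    have hshift := (AgreeOn.shift_lt_shift_iff hag).2 heα
    rw [heq] at hshift
    exact (he.reflectSeq_lt_shift_of_mem hpU hk).asymm
      (hshift.trans (reflectSeq_lt_reflectSeq_iff.2 heα))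
  · obtain ⟨j, hj, hjlt⟩ := toLex_lt_iff.1 hlt
    obtain ⟨p, hpU, -, e, he, hag⟩ := h.exists_agreeOn hq hα hmem (k + (j + 1))
    have hpre : PrefixLT (j + 1) (shift k e) (reflectSeq e) :=
      PrefixLT.congr ⟨j, j.lt_succ_self, hj, hjlt⟩ hag.symm.shift
        (agreeOn_reflectSeq_iff.2 (hag.symm.mono (by omega)))
    exact (he.reflectSeq_lt_shift_of_mem hpU hk).asymm hpre.lt

lemma reflectSeq_lt_shift (h : IsUnivoqueGap m q r) (hM : ((m / 2 + 1 : ℕ) : ℝ) < q)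
    (hα : IsQuasiGreedy q 1 α) (k : ℕ) : toLex (reflectSeq α) < toLex (shift k α) := by
  have hq := one_lt_of_half_add_one_lt hM
  rcases Nat.eq_zero_or_pos k with rfl | hk
  · have hhead : m / 2 + 1 < (α 0 : ℕ) + 1 := by
      exact_mod_cast hM.trans_le (hα.le_head_add_one hq)
    refine toLex_lt_iff.2 ⟨0, by simp [AgreeOn], ?_⟩
    rw [shift_zero, reflectSeq_apply, Fin.lt_def, Fin.val_rev]
    omega
  · exact h.reflectSeq_lt_shift_of_pos hq hα hk

lemma periodDoubling (h : IsUnivoqueGap m q r) (hM : ((m / 2 + 1 : ℕ) : ℝ) < q)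
    (hα : IsQuasiGreedy q 1 α) {a : List (Fin (m + 1))} (ha : IsSmallestBlock a α) :
    PeriodDoubling a.length (periodicSeq a) (limitSeq a) := by
  have hq := one_lt_of_half_add_one_lt hM
  obtain ⟨hne, rfl, hmin⟩ := ha
  have hlast : periodicSeq a (a.length - 1) < Fin.last m := by
    refine hα.lt_last_of_shift_eq hq (h.lt.trans_le h.right_le) ?_
    rw [Nat.sub_add_cancel (List.length_pos_iff.2 hne), shift_length_periodicSeq]
  have hsucc := prefixSucc_limitSeq hne hlast
  refine ⟨shift_length_periodicSeq a, hsucc, ?_, doubles_limitSeq hne hlast⟩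
  refine adm_of_periodic hsucc (shift_length_periodicSeq a) (fun i hi hin heq => ?_)
    (hα.shift_le hq) (h.reflectSeq_lt_shift hM hα)
  refine (hmin i hi fun j => ?_).not_gt hin
  rw [add_comm j i]
  exact congrFun heq j

end IsUnivoqueGap

namespace PeriodDoubling

variable {n : ℕ} {x c : ℕ → Fin (m + 1)} {q r : ℝ}

lemma infNonzero (h : PeriodDoubling n x c) : InfNonzero c := by
  intro k
  obtain ⟨j, -, hj⟩ := toLex_lt_iff.1 (h.reflectSeq_lt_shift k)
  exact ⟨k + j, by omega, ((Fin.zero_le _).trans_lt hj).ne'⟩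

lemma exists_base (h : PeriodDoubling n x c) (hq : 1 < q) (hx : IsQuasiGreedy q 1 x) :
    ∃ p ∈ univoqueBases m, q < p ∧ IsQuasiGreedy p 1 c := by
  have hqm := le_add_one_of_val_eq_one hq hx.val_eq
  have hleft : 1 < val q c := hx.one_lt_val hq h.lt h.infNonzero
  have hright : val (m + 1) c ≤ 1 := by
    refine (val_le (hq.trans_le hqm) c).trans ?_
    rw [add_sub_cancel_right]
    exact div_self_le_one _
  obtain ⟨p, ⟨hqp, -⟩, hp⟩ := intermediate_value_Icc' hqm
    ((continuousOn_val hq c).mono fun _ h => h.1) ⟨hright, hleft.le⟩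
  have hp : val p c = 1 := hp
  have hqp : q < p := hqp.lt_of_ne fun heq => hleft.ne' (heq ▸ hp)
  have hp1 : 1 < p := hq.trans hqp
  have hc : IsQuasiGreedy p 1 c := isQuasiGreedy_of_shift_le hp1 hp h.infNonzero fun k => by
    rcases Nat.eq_zero_or_pos k with rfl | hk
    · rw [shift_zero]
    · exact (h.shift_lt hk).le
  refine ⟨p, (hc.mem_univoqueBases_iff hp1).2 ((mem_univoqueSeqs_iff hp1 hc).2 ⟨?_, ?_⟩), hqp, hc⟩
  · exact fun k _ => h.shift_lt k.succ_pos
  · exact fun k _ => reflectSeq_lt_comm.2 (h.reflectSeq_lt_shift (k + 1))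

lemma isQuasiGreedy_right (h : PeriodDoubling n x c) (hq : 1 < q) (hx : IsQuasiGreedy q 1 x)
    (hgap : IsUnivoqueGap m q r) : IsQuasiGreedy r 1 c := by
  obtain ⟨p, hp, hqp, hc⟩ := h.exists_base hq hx
  have hrp : r ≤ p := not_lt.1 fun hpr => hgap.notMem_Ioo p hp ⟨hqp, hpr⟩
  rcases hrp.eq_or_lt with rfl | hrp
  · exact hc
  obtain ⟨s, ⟨hqs, hsp⟩, hs⟩ := mem_closure_iff_nhds.1 hgap.right_mem _ (Ioo_mem_nhds hgap.lt hrp)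
  have hs1 : 1 < s := hs.1.1
  obtain ⟨e, he⟩ := exists_isQuasiGreedy hs1 hs.1.2
  have hle := h.le_of_lt (hx.lt_of_base_lt hq hqs he) (he.shift_le hs1)
    fun k => he.reflectSeq_lt_shift_of_mem hs
  exact absurd (he.lt_of_base_lt hs1 hsp hc) hle.not_gt

end PeriodDoubling

/-! ### Infinite products of words -/

section InfProd

variable {F : ℕ → List (Fin (m + 1)) × ℕ∞} {s : ℕ → Fin (m + 1)}

variable (F) in
lemma finProd_succ (N : ℕ) :
    finProd F (N + 1) = finProd F N ++ (List.replicate (F N).2.toNat (F N).1).flatten := by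
  simp [finProd, List.range_succ]

variable (F) in
lemma finProd_succ' (N : ℕ) :
    finProd F (N + 1) = (List.replicate (F 0).2.toNat (F 0).1).flatten ++
      finProd (fun s => F (s + 1)) N := by
  simp [finProd, List.range_succ_eq_map, Function.comp_def]

variable (F) in
lemma finProd_prefix_finProd {N K : ℕ} (h : N ≤ K) : finProd F N <+: finProd F K := by
  induction K, h using Nat.le_induction with
  | base => exact List.prefix_rfl
  | succ K _ ih => exact ih.trans (finProd_succ F K ▸ List.prefix_append _ _)

lemma isInfProd_of_ne_top {t : ℕ → Fin (m + 1)} (h0 : (F 0).2 ≠ ⊤)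
    (ht : IsInfProd (fun s => F (s + 1)) t) :
    IsInfProd F (appendSeq (List.replicate (F 0).2.toNat (F 0).1).flatten t) := by
  rcases ht with ⟨r, hr, hrtop, rfl⟩ | ⟨hfin, happ, hlen⟩
  · refine Or.inl ⟨r + 1, fun k hk => ?_, hrtop, by rw [finProd_succ', appendSeq_append]⟩
    cases k with
    | zero => exact h0
    | succ k => exact hr k (by omega)
  · refine Or.inr ⟨fun k => k.casesOn h0 hfin, fun N => ?_, fun L => ?_⟩
    · cases N with
      | zero => exact ⟨_, (appendSeq_nil _).symm⟩
      | succ N =>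
        obtain ⟨t', ht'⟩ := happ N
        exact ⟨t', by rw [finProd_succ', appendSeq_append, ← ht']⟩
    · obtain ⟨N, hN⟩ := hlen L
      refine ⟨N + 1, hN.trans ?_⟩
      rw [finProd_succ', List.length_append]
      exact Nat.le_add_left _ _

lemma IsInfProd.exists_tail (h : IsInfProd F s) (h0 : (F 0).2 ≠ ⊤) :
    ∃ t, s = appendSeq (List.replicate (F 0).2.toNat (F 0).1).flatten t ∧
      IsInfProd (fun s => F (s + 1)) t := by
  rcases h with ⟨r, hr, hrtop, rfl⟩ | ⟨hfin, happ, hlen⟩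
  · obtain ⟨r, rfl⟩ := Nat.exists_eq_add_one_of_ne_zero fun hr0 => h0 (hr0 ▸ hrtop)
    exact ⟨_, by rw [finProd_succ', appendSeq_append],
      Or.inl ⟨r, fun k hk => hr (k + 1) (by omega), hrtop, rfl⟩⟩
  · obtain ⟨t, ht⟩ := happ 1
    rw [finProd_succ', appendSeq_append, show finProd _ 0 = [] from rfl, appendSeq_nil] at ht
    refine ⟨t, ht, Or.inr ⟨fun k => hfin (k + 1), fun N => ?_, fun L => ?_⟩⟩
    · obtain ⟨t', ht'⟩ := happ (N + 1)
      rw [finProd_succ', appendSeq_append, ht] at ht'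
      exact ⟨t', appendSeq_injective _ ht'⟩
    · obtain ⟨N, hN⟩ := hlen (L + (List.replicate (F 0).2.toNat (F 0).1).flatten.length)
      have hNle := hN.trans (finProd_prefix_finProd F N.le_succ).length_le
      rw [Nat.succ_eq_add_one, finProd_succ', List.length_append] at hNle
      exact ⟨N, by omega⟩

lemma IsInfProd.eq_periodicSeq (h : IsInfProd F s) (h0 : (F 0).2 = ⊤) :
    s = periodicSeq (F 0).1 := by
  rcases h with ⟨r, hr, -, rfl⟩ | ⟨hfin, -⟩
  · obtain rfl : r = 0 := Nat.eq_zero_of_not_pos fun hr0 => hr 0 hr0 h0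
    exact appendSeq_nil _
  · exact absurd h0 (hfin 0)

lemma isInfProd_of_top (h0 : (F 0).2 = ⊤) : IsInfProd F (periodicSeq (F 0).1) :=
  Or.inl ⟨0, by simp, h0, (appendSeq_nil _).symm⟩

lemma IsInfProd.tail (h : IsInfProd F s) (h0 : (F 0).2 = 0) :
    IsInfProd (fun s => F (s + 1)) s := by
  obtain ⟨t, rfl, ht⟩ := h.exists_tail (by simp [h0])
  simpa [h0] using ht

lemma IsInfProd.split (h : IsInfProd F s) {k : ℕ∞} (h0 : (F 0).2 = k + 1) :
    ∃ t, s = appendSeq (F 0).1 t ∧ IsInfProd (Function.update F 0 ((F 0).1, k)) t := by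
  rcases eq_or_ne k ⊤ with rfl | hk
  · refine ⟨s, ?_, ?_⟩
    · rw [h.eq_periodicSeq h0, appendSeq_periodicSeq]
    · rw [h.eq_periodicSeq h0]
      simpa using isInfProd_of_top (F := Function.update F 0 ((F 0).1, ⊤)) (by simp)
  · lift k to ℕ using hk
    have htoNat : (F 0).2.toNat = k + 1 := by rw [h0]; rfl
    obtain ⟨t, rfl, ht⟩ := h.exists_tail (by rw [h0]; exact ENat.natCast_ne_top (k + 1))
    refine ⟨appendSeq (List.replicate k (F 0).1).flatten t, ?_, ?_⟩
    · rw [htoNat, List.replicate_succ, List.flatten_cons, appendSeq_append]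
    · simpa using isInfProd_of_ne_top (F := Function.update F 0 ((F 0).1, (k : ℕ∞)))
        (by simp) (by simpa using ht)

lemma IsInfProd.exists_exp_ne_zero (h : IsInfProd F s) : ∃ N, (F N).2 ≠ 0 := by
  rcases h with ⟨r, -, hr, -⟩ | ⟨-, -, hlen⟩
  · exact ⟨r, by simp [hr]⟩
  · by_contra! hzero
    obtain ⟨N, hN⟩ := hlen 1
    simp [finProd, hzero] at hN

lemma isInfProd_of_tails {t : ℕ → ℕ → Fin (m + 1)}
    (htop : ∀ N, (F N).2 = ⊤ → t N = periodicSeq (F N).1)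
    (hfin : ∀ N, (F N).2 ≠ ⊤ →
      t N = appendSeq (List.replicate (F N).2.toNat (F N).1).flatten (t (N + 1)))
    (hne : ∀ R, ∃ N ≥ R, t N ≠ t R) : IsInfProd F (t 0) := by
  have happ (N : ℕ) (hN : ∀ k < N, (F k).2 ≠ ⊤) : t 0 = appendSeq (finProd F N) (t N) := by
    induction N with
    | zero => exact (appendSeq_nil _).symm
    | succ N ih =>
      rw [finProd_succ, appendSeq_append, ← hfin N (hN N N.lt_succ_self)]
      exact ih fun k hk => hN k (hk.trans N.lt_succ_self)
  classical
  by_cases h : ∃ r, (F r).2 = ⊤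
  · have hmin (k : ℕ) (hk : k < Nat.find h) : (F k).2 ≠ ⊤ := Nat.find_min h hk
    refine Or.inl ⟨Nat.find h, hmin, Nat.find_spec h, ?_⟩
    rw [← htop _ (Nat.find_spec h)]
    exact happ _ hmin
  · push Not at h
    refine Or.inr ⟨h, fun N => ⟨t N, happ N fun k _ => h k⟩, fun L => ?_⟩
    have htail (N : ℕ) : t N = shift (finProd F N).length (t 0) := by
      rw [happ N fun k _ => h k, shift_length_appendSeq]
    induction L with
    | zero => exact ⟨0, Nat.zero_le _⟩
    | succ L ih =>
      obtain ⟨R, hR⟩ := ih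
      obtain ⟨N, hRN, hN⟩ := hne R
      have hle := (finProd_prefix_finProd F hRN).length_le
      have hlen : (finProd F N).length ≠ (finProd F R).length := fun hlen =>
        hN (by rw [htail N, htail R, hlen])
      exact ⟨N, by omega⟩

end InfProd

/-! ### Products of the words `c_p c̄_q` -/

/-- The sequence `y` lies strictly between the reflection of `c` and `c`. -/
def IsBetween (c y : ℕ → Fin (m + 1)) : Prop :=
  toLex (reflectSeq c) < toLex y ∧ toLex y < toLex c

/-- All tails of `y` lie strictly between the reflection of `c` and `c`. -/
def TailsBetween (c y : ℕ → Fin (m + 1)) : Prop := ∀ k, IsBetween c (shift k y)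

section Between

variable {c y : ℕ → Fin (m + 1)}

lemma isBetween_reflectSeq_iff : IsBetween c (reflectSeq y) ↔ IsBetween c y := by
  rw [IsBetween, reflectSeq_lt_reflectSeq_iff, reflectSeq_lt_comm, and_comm, IsBetween]

lemma TailsBetween.shift (h : TailsBetween c y) (k : ℕ) : TailsBetween c (shift k y) := fun l => by
  rw [shift_shift]
  exact h _

lemma TailsBetween.ne (h : TailsBetween c y) : y ≠ c := by
  rintro rfl
  exact lt_irrefl _ (shift_zero y ▸ (h 0).2)

end Between

/-- The word `c_p c̄_q`. -/
def pairWord (a : List (Fin (m + 1))) (p q : ℕ) : List (Fin (m + 1)) :=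
  blockWord a p ++ reflect (blockWord a q)

lemma pairWord_eq_append (a : List (Fin (m + 1))) (p q : ℕ) :
    pairWord a p q = initWord (a.length * 2 ^ p) (limitSeq a) ++
      initWord (a.length * 2 ^ q) (reflectSeq (limitSeq a)) := by
  rw [pairWord, blockWord_eq_initWord, blockWord_eq_initWord, reflect_initWord]

lemma length_pairWord (a : List (Fin (m + 1))) (p q : ℕ) :
    (pairWord a p q).length = a.length * 2 ^ p + a.length * 2 ^ q := by
  simp [pairWord_eq_append]

lemma initWord_eq_pairWord_iff {a : List (Fin (m + 1))} {y : ℕ → Fin (m + 1)} {p q : ℕ} :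
    initWord (pairWord a p q).length y = pairWord a p q ↔
      AgreeOn (a.length * 2 ^ p) y (limitSeq a) ∧
        AgreeOn (a.length * 2 ^ q) (shift (a.length * 2 ^ p) y) (reflectSeq (limitSeq a)) := by
  rw [length_pairWord, pairWord_eq_append, initWord_add, ← initWord_eq_initWord_iff,
    ← initWord_eq_initWord_iff]
  exact ⟨fun h => List.append_inj h (by simp), fun h => by rw [h.1, h.2]⟩

namespace PeriodDoubling

variable {n p q k : ℕ} {x c y : ℕ → Fin (m + 1)}

lemma length_pos (h : PeriodDoubling n x c) (p : ℕ) : 0 < n * 2 ^ p :=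
  (Nat.zero_le p).trans_lt (h.lt_length p)

lemma isBetween_shift (h : PeriodDoubling n x c) (hpq : p ≤ q)
    (hy : AgreeOn (n * 2 ^ p) y c) (hy' : AgreeOn (n * 2 ^ q) (shift (n * 2 ^ p) y) (reflectSeq c))
    (hk : k < n * 2 ^ p) : IsBetween c (shift k y) := by
  have hy'' := hy'.mono (show n * 2 ^ p ≤ n * 2 ^ q by gcongr; norm_num)
  refine ⟨(h.adm_pow p).reflectSeq_lt_shift hy hk, ?_⟩
  rcases Nat.eq_zero_or_pos k with rfl | hk0
  · rw [shift_zero]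
    exact (hy.prefixLT_add ((h.doubles p).prefixLT.congr hy''.symm (AgreeOn.refl _ _))).lt
  · exact ((h.adm_pow p).prefixLT_shift hy (hy''.mono (Nat.sub_le _ _)) hk0 hk).lt

lemma isBetween_shift_of_lt_add (h : PeriodDoubling n x c) (hpq : p ≤ q)
    (hy : AgreeOn (n * 2 ^ p) y c) (hy' : AgreeOn (n * 2 ^ q) (shift (n * 2 ^ p) y) (reflectSeq c))
    (hy'' : AgreeOn (n * 2 ^ q) (shift (n * 2 ^ p + n * 2 ^ q) y) c)
    (hk : k < n * 2 ^ p + n * 2 ^ q) : IsBetween c (shift k y) := by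
  rcases lt_or_ge k (n * 2 ^ p) with hkp | hkp
  · exact h.isBetween_shift hpq hy hy' hkp
  · obtain ⟨i, rfl⟩ := Nat.exists_eq_add_of_le hkp
    rw [← isBetween_reflectSeq_iff, ← shift_shift, ← shift_reflectSeq]
    refine h.isBetween_shift le_rfl (p := q) ?_ ?_ (by omega)
    · rwa [← agreeOn_reflectSeq_iff, reflectSeq_reflectSeq]
    · rwa [shift_reflectSeq, agreeOn_reflectSeq_iff, shift_shift]

end PeriodDoubling

section PairProduct

variable {a : List (Fin (m + 1))} {x y s : ℕ → Fin (m + 1)}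

lemma tailsBetween_of_coinduction (h : PeriodDoubling a.length x (limitSeq a))
    {R : ℕ → (ℕ → Fin (m + 1)) → Prop}
    (hR : ∀ i s, R i s → ∃ p q t, i ≤ p ∧ p ≤ q ∧ s = appendSeq (pairWord a p q) t ∧ R q t)
    {i : ℕ} (hs : R i s) :
    TailsBetween (limitSeq a) s ∧ AgreeOn (a.length * 2 ^ i) s (limitSeq a) := by
  have hsplit {p q : ℕ} {t : ℕ → Fin (m + 1)} := initWord_eq_pairWord_iff.1
    (initWord_appendSeq (pairWord a p q) t)
  have hhead (i : ℕ) (s : ℕ → Fin (m + 1)) (hs : R i s) :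
      AgreeOn (a.length * 2 ^ i) s (limitSeq a) := by
    obtain ⟨p, q, t, hip, -, rfl, -⟩ := hR i s hs
    exact hsplit.1.mono (by gcongr; norm_num)
  refine ⟨fun k => ?_, hhead i s hs⟩
  induction k using Nat.strong_induction_on generalizing i s with
  | _ k ih =>
    obtain ⟨p, q, t, -, hpq, rfl, ht⟩ := hR i s hs
    rcases lt_or_ge k (pairWord a p q).length with hk | hk
    · rw [length_pairWord] at hk
      refine h.isBetween_shift_of_lt_add hpq hsplit.1 hsplit.2 ?_ hk
      rw [← length_pairWord, shift_length_appendSeq]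
      exact hhead q t ht
    · obtain ⟨l, rfl⟩ := Nat.exists_eq_add_of_le hk
      rw [shift_length_add_appendSeq]
      refine ih l (Nat.lt_add_of_pos_left ?_) ht
      rw [length_pairWord]
      exact Nat.add_pos_left (h.length_pos p) _

/-- The factors of `F` are powers of words `c_p c̄_q` with nondecreasing indices, in which a word
with `p ≠ q` is not repeated. -/
structure IsPairProduct (a : List (Fin (m + 1))) (F : ℕ → List (Fin (m + 1)) × ℕ∞) (p q : ℕ → ℕ) :
    Prop where
  word : ∀ t, (F t).1 = pairWord a (p t) (q t)
  le : ∀ t, p t ≤ q t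
  le_succ : ∀ t, q t ≤ p (t + 1)
  eq_or_le_one : ∀ t, p t = q t ∨ (F t).2 ≤ 1

variable {F : ℕ → List (Fin (m + 1)) × ℕ∞} {p q : ℕ → ℕ}

lemma IsPairProduct.tail (hF : IsPairProduct a F p q) :
    IsPairProduct a (fun t => F (t + 1)) (fun t => p (t + 1)) (fun t => q (t + 1)) :=
  ⟨fun _ => hF.word _, fun _ => hF.le _, fun _ => hF.le_succ _, fun _ => hF.eq_or_le_one _⟩

lemma IsPairProduct.split (hF : IsPairProduct a F p q) (hs : IsInfProd F s) (h0 : (F 0).2 ≠ 0) :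
    ∃ t F' p' q', s = appendSeq (pairWord a (p 0) (q 0)) t ∧ IsPairProduct a F' p' q' ∧
      q 0 ≤ p' 0 ∧ IsInfProd F' t := by
  obtain ⟨k, hk⟩ : ∃ k, (F 0).2 = k + 1 :=
    ⟨(F 0).2 - 1, (tsub_add_cancel_of_le (Order.one_le_iff_ne_zero.2 h0)).symm⟩
  obtain ⟨t, rfl, ht⟩ := hs.split hk
  rw [hF.word 0]
  rcases eq_or_ne k 0 with rfl | hk0
  · exact ⟨t, _, _, _, rfl, hF.tail, hF.le_succ 0, by simpa using ht.tail (by simp)⟩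
  · have hpq : p 0 = q 0 := (hF.eq_or_le_one 0).resolve_right fun hle => hk0 <| by
      have hle' : k + 1 ≤ 0 + 1 := by rwa [zero_add, ← hk]
      exact nonpos_iff_eq_zero.1 ((ENat.add_le_add_iff_right ENat.one_ne_top).1 hle')
    refine ⟨t, _, p, q, rfl, ⟨fun t => ?_, hF.le, hF.le_succ, fun t => ?_⟩, hpq.ge, ht⟩
    all_goals cases t
    · simpa using hF.word 0
    · exact hF.word _
    · exact Or.inl hpq
    · exact hF.eq_or_le_one _

lemma IsPairProduct.exists_split (hF : IsPairProduct a F p q) (hs : IsInfProd F s) :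
    ∃ i j t F' p' q', p 0 ≤ i ∧ i ≤ j ∧ s = appendSeq (pairWord a i j) t ∧
      IsPairProduct a F' p' q' ∧ j ≤ p' 0 ∧ IsInfProd F' t := by
  obtain ⟨N, hN⟩ := hs.exists_exp_ne_zero
  induction N generalizing F p q with
  | zero =>
    obtain ⟨t, F', p', q', hsplit⟩ := hF.split hs hN
    exact ⟨p 0, q 0, t, F', p', q', le_rfl, hF.le 0, hsplit⟩
  | succ N ih =>
    by_cases h0 : (F 0).2 = 0
    · obtain ⟨i, j, t, F', p', q', hi, hsplit⟩ := ih hF.tail (hs.tail h0) hN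
      exact ⟨i, j, t, F', p', q', ((hF.le 0).trans (hF.le_succ 0)).trans hi, hsplit⟩
    · obtain ⟨t, F', p', q', hsplit⟩ := hF.split hs h0
      exact ⟨p 0, q 0, t, F', p', q', le_rfl, hF.le 0, hsplit⟩

lemma IsPairProduct.tailsBetween (hF : IsPairProduct a F p q)
    (h : PeriodDoubling a.length x (limitSeq a)) (hs : IsInfProd F s) :
    TailsBetween (limitSeq a) s ∧ AgreeOn a.length s (limitSeq a) := by
  let R (i : ℕ) (s : ℕ → Fin (m + 1)) : Prop :=
    ∃ F p q, IsPairProduct a F p q ∧ i ≤ p 0 ∧ IsInfProd F s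
  have hR (i : ℕ) (s : ℕ → Fin (m + 1)) (hs : R i s) :
      ∃ p q t, i ≤ p ∧ p ≤ q ∧ s = appendSeq (pairWord a p q) t ∧ R q t := by
    obtain ⟨F, p, q, hF, hi, hs⟩ := hs
    obtain ⟨i', j, t, F', p', q', hi', hij, hst, hF', hj, ht⟩ := hF.exists_split hs
    exact ⟨i', j, t, hi.trans hi', hij, hst, F', p', q', hF', hj, ht⟩
  simpa using tailsBetween_of_coinduction h hR (i := 0) ⟨F, p, q, hF, Nat.zero_le _, hs⟩

end PairProduct

section Decomposition

variable {a : List (Fin (m + 1))} {x y : ℕ → Fin (m + 1)} {i : ℕ}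
variable (h : PeriodDoubling a.length x (limitSeq a))
include h

lemma TailsBetween.exists_pairWord_or (hy : TailsBetween (limitSeq a) y)
    (hi : AgreeOn (a.length * 2 ^ i) y (limitSeq a)) :
    (∃ q ≥ i, initWord (pairWord a i q).length y = pairWord a i q ∧
      AgreeOn (a.length * 2 ^ q) (QExpansion.shift (pairWord a i q).length y) (limitSeq a)) ∨
    AgreeOn (a.length * 2 ^ (i + 1)) y (limitSeq a) := by
  have hy0 : IsBetween (limitSeq a) y := shift_zero y ▸ hy 0
  rcases (h.doubles i).next_block hi hy0.2 (hy _).1 with hnext | hnext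
  · set z := QExpansion.shift (a.length * 2 ^ i) y with hz
    have hzT : TailsBetween (limitSeq a) z := hy.shift _
    have hz0 : IsBetween (limitSeq a) z := hy _
    obtain ⟨q, hiq, hq, hqmax⟩ := h.exists_max_agreeOn (k := i) (y := reflectSeq z)
      (by rwa [← agreeOn_reflectSeq_iff, reflectSeq_reflectSeq])
      (by
        intro heq
        exact lt_irrefl _ (heq ▸ (isBetween_reflectSeq_iff.2 hz0).2))
    have hq' : AgreeOn (a.length * 2 ^ q) z (reflectSeq (limitSeq a)) := by
      rwa [← agreeOn_reflectSeq_iff, reflectSeq_reflectSeq]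
    refine Or.inl ⟨q, hiq, initWord_eq_pairWord_iff.2 ⟨hi, hq'⟩, ?_⟩
    rw [length_pairWord, ← shift_shift, ← hz]
    refine ((h.doubles q).next_block_reflectSeq hq' hz0.1 (hzT _).2).resolve_right fun hdouble => ?_
    exact hqmax (by rwa [← agreeOn_reflectSeq_iff, reflectSeq_reflectSeq])
  · exact Or.inr (by rwa [show a.length * 2 ^ (i + 1) = 2 * (a.length * 2 ^ i) by ring])

lemma TailsBetween.eq_periodicSeq_or (hy : TailsBetween (limitSeq a) y)
    (hi : AgreeOn (a.length * 2 ^ i) y (limitSeq a)) :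
    y = periodicSeq (pairWord a i i) ∨ ∃ J l i' y', l ≤ 1 ∧ i < i' ∧
      y = appendSeq (List.replicate J (pairWord a i i)).flatten
        (appendSeq (List.replicate l (pairWord a i i')).flatten y') ∧
      TailsBetween (limitSeq a) y' ∧ AgreeOn (a.length * 2 ^ i') y' (limitSeq a) := by
  classical
  set w := pairWord a i i
  let Repeats (J : ℕ) : Prop := initWord w.length (QExpansion.shift (w.length * J) y) = w ∧
    AgreeOn (a.length * 2 ^ i) (QExpansion.shift (w.length * (J + 1)) y) (limitSeq a)
  by_cases hall : ∀ J, Repeats J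
  · refine Or.inl (eq_periodicSeq ?_ fun J => (hall J).1)
    rw [← List.length_pos_iff, length_pairWord]
    exact Nat.add_pos_left (h.length_pos i) _
  push Not at hall
  obtain ⟨J, hJ, hmin⟩ : ∃ J, ¬ Repeats J ∧ ∀ k < J, Repeats k :=
    ⟨Nat.find hall, Nat.find_spec hall, fun k hk => not_not.1 (Nat.find_min hall hk)⟩
  have hyJ := eq_appendSeq_replicate fun k hk => (hmin k hk).1
  set z := QExpansion.shift (w.length * J) y with hz
  have hzT : TailsBetween (limitSeq a) z := hy.shift _
  have hzi : AgreeOn (a.length * 2 ^ i) z (limitSeq a) := by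
    cases J with
    | zero => simpa [hz] using hi
    | succ J => exact (hmin J J.lt_succ_self).2
  rcases hzT.exists_pairWord_or h hzi with ⟨q, hiq, hzq, hq⟩ | hz'
  · have hne : i ≠ q := by
      rintro rfl
      exact hJ ⟨hzq, by rwa [Nat.mul_succ, ← shift_shift]⟩
    refine Or.inr ⟨J, 1, q, _, le_rfl, hiq.lt_of_ne hne, ?_, hzT.shift _, hq⟩
    rwa [List.replicate_one, List.flatten_singleton, ← eq_appendSeq_of_initWord_eq hzq]
  · exact Or.inr ⟨J, 0, i + 1, z, zero_le_one, i.lt_succ_self, by simpa using hyJ, hzT, hz'⟩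

lemma tailsBetween_periodicSeq_pairWord (i : ℕ) :
    TailsBetween (limitSeq a) (periodicSeq (pairWord a i i)) ∧
      AgreeOn (a.length * 2 ^ i) (periodicSeq (pairWord a i i)) (limitSeq a) :=
  tailsBetween_of_coinduction h (R := fun k s => k ≤ i ∧ s = periodicSeq (pairWord a i i))
    (fun _ _ ⟨hk, hs⟩ =>
      ⟨i, i, _, hk, le_rfl, hs.trans (appendSeq_periodicSeq _).symm, le_rfl, rfl⟩)
    ⟨le_rfl, rfl⟩

/-- A formally infinite number of copies of `c_i c̄_i` is followed by a dummy sequence `y'`, so that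
this step can be iterated unconditionally. -/
lemma TailsBetween.exists_step (hy : TailsBetween (limitSeq a) y)
    (hi : AgreeOn (a.length * 2 ^ i) y (limitSeq a)) :
    ∃ (J : ℕ∞) (l i' : ℕ) (y' : ℕ → Fin (m + 1)), l ≤ 1 ∧ i < i' ∧
      (TailsBetween (limitSeq a) y' ∧ AgreeOn (a.length * 2 ^ i') y' (limitSeq a)) ∧
      (J = ⊤ → y = periodicSeq (pairWord a i i)) ∧
      (J ≠ ⊤ → y = appendSeq (List.replicate J.toNat (pairWord a i i)).flatten
        (appendSeq (List.replicate l (pairWord a i i')).flatten y')) := by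
  rcases hy.eq_periodicSeq_or h hi with hper | ⟨J, l, i', y', hl, hii', happ, hy', hi'⟩
  · exact ⟨⊤, 0, i + 1, _, zero_le_one, i.lt_succ_self, tailsBetween_periodicSeq_pairWord h (i + 1),
      fun _ => hper, fun hne => absurd rfl hne⟩
  · exact ⟨J, l, i', y', hl, hii', ⟨hy', hi'⟩, fun htop => absurd htop (ENat.natCast_ne_top J),
      fun _ => happ⟩

omit h in
lemma isInfProd_factors {i : ℕ → ℕ} {js : ℕ → ℕ∞} {l : ℕ → ℕ} {s : ℕ → ℕ → Fin (m + 1)}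
    (htop : ∀ r, js r = ⊤ → s r = periodicSeq (pairWord a (i r) (i r)))
    (hfin : ∀ r, js r ≠ ⊤ →
      s r = appendSeq (List.replicate (js r).toNat (pairWord a (i r) (i r))).flatten
        (appendSeq (List.replicate (l r) (pairWord a (i r) (i (r + 1)))).flatten (s (r + 1))))
    (hne : ∀ R, ∃ r ≥ R, s r ≠ s R) : IsInfProd (factors a 0 i js l) (s 0) := by
  let t (N : ℕ) : ℕ → Fin (m + 1) := if N % 2 = 0 then s (N / 2) else
    appendSeq (List.replicate (l (N / 2)) (pairWord a (i (N / 2)) (i (N / 2 + 1)))).flatten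
      (s (N / 2 + 1))
  have hteven (r : ℕ) : t (2 * r) = s r := by simp [t]
  have htodd (r : ℕ) : t (2 * r + 1) = appendSeq
      (List.replicate (l r) (pairWord a (i r) (i (r + 1)))).flatten (s (r + 1)) := by
    simp [t, Nat.add_mod, Nat.mul_add_div]
  have hFeven (r : ℕ) : factors a 0 i js l (2 * r + 1) = (pairWord a (i r) (i r), js r) := by
    simp [factors, pairWord]
  have hFodd (r : ℕ) : factors a 0 i js l (2 * r + 1 + 1) =
      (pairWord a (i r) (i (r + 1)), (l r : ℕ∞)) := by
    simp [factors, pairWord, Nat.add_mod, Nat.mul_add_div]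
  have hprod : IsInfProd (fun N => factors a 0 i js l (N + 1)) (t 0) := by
    refine isInfProd_of_tails (fun N hN => ?_) (fun N hN => ?_) fun R => ?_
    · obtain ⟨r, rfl | rfl⟩ := Nat.even_or_odd' N
      · rw [hFeven] at hN ⊢
        exact (hteven r).trans (htop r hN)
      · rw [hFodd] at hN
        exact absurd hN (ENat.natCast_ne_top (l r))
    · obtain ⟨r, rfl | rfl⟩ := Nat.even_or_odd' N
      · rw [hFeven] at hN ⊢
        rw [hteven, htodd]
        exact hfin r hN
      · rw [hFodd, htodd, ENat.toNat_natCast, show 2 * r + 1 + 1 = 2 * (r + 1) by ring, hteven]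
    · by_contra! hconst
      obtain ⟨r, hr, hsr⟩ := hne R
      refine hsr ?_
      rw [← hteven r, ← hteven R, hconst (2 * r) (by omega), hconst (2 * R) (by omega)]
  simpa [factors, t] using isInfProd_of_ne_top (F := factors a 0 i js l) (by simp [factors]) hprod

lemma TailsBetween.exists_isInfProd (hy : TailsBetween (limitSeq a) y)
    (h0 : AgreeOn a.length y (limitSeq a)) :
    ∃ i js l, StrictMono i ∧ (∀ r, l r ≤ 1) ∧ IsInfProd (factors a 0 i js l) y := by
  let State := {S : ℕ × (ℕ → Fin (m + 1)) //
    TailsBetween (limitSeq a) S.2 ∧ AgreeOn (a.length * 2 ^ S.1) S.2 (limitSeq a)}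
  choose! J l i' y' hl hlt hnext htop hfin using fun S : State =>
    TailsBetween.exists_step h S.2.1 S.2.2
  let S (r : ℕ) : State := (fun S => ⟨(i' S, y' S), hnext S⟩)^[r] ⟨(0, y), hy, by simpa using h0⟩
  have hS (r : ℕ) : (S (r + 1)).1 = (i' (S r), y' (S r)) := by
    simp only [S, Function.iterate_succ_apply']
  have hmono : StrictMono fun r => (S r).1.1 := strictMono_nat_of_lt_succ fun r => by
    rw [hS]
    exact hlt _
  refine ⟨fun r => (S r).1.1, fun r => J (S r), fun r => l (S r), hmono, fun r => hl _,
    isInfProd_factors (s := fun r => (S r).1.2) (fun r => htop _) (fun r hr => ?_) fun R => ?_⟩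
  · rw [hS]
    exact hfin _ hr
  · by_contra! hconst
    refine (S R).2.1.ne (funext fun k => ?_)
    rw [← hconst (R + k) (Nat.le_add_right R k)]
    refine (S (R + k)).2.2 k ?_
    exact ((Nat.le_add_left k R).trans (hmono.id_le _)).trans_lt (h.lt_length _)

end Decomposition

/-! ### Matched words -/

/-- The tails of `z` which start at most at position `p` and after some digit less than `m` do not
exceed `x` in their first `n` digits. Matched words are defined by this condition on a sequence and
on its reflection. -/
def PrefixUpperCond (n p : ℕ) (x z : ℕ → Fin (m + 1)) : Prop :=
  ∀ l, 1 ≤ l → l ≤ p → (∃ j < l, z j < Fin.last m) → ¬ PrefixLT n x (shift l z)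

lemma matched_initWord_iff {n p : ℕ} {z : ℕ → Fin (m + 1)} :
    Matched (initWord n (shift p z)) (initWord p z) ↔
      (0 < p ∧ z (p - 1) < Fin.last m) ∧ PrefixUpperCond n p (shift p z) z ∧
        PrefixUpperCond n p (shift p z) (reflectSeq z) := by
  have hlast : (∃ h : initWord p z ≠ [], (initWord p z).getLast h < Fin.last m) ↔
      0 < p ∧ z (p - 1) < Fin.last m := by
    cases p with
    | zero => simp [initWord]
    | succ p => simp [initWord_succ]
  have hblock (l : ℕ) (hl : l ≤ p) :
      ((initWord p z ++ initWord n (shift p z)).drop l).take n = initWord n (shift l z) := by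
    obtain ⟨k, rfl⟩ := Nat.exists_eq_add_of_le hl
    rw [← initWord_add, Nat.add_assoc, drop_initWord_add, take_initWord (Nat.le_add_left n k)]
  have hne (l : ℕ) (hl : l ≤ p) (d : Fin (m + 1)) :
      (initWord p z).take l ≠ List.replicate l d ↔ ∃ j < l, z j ≠ d := by
    rw [take_initWord hl, Ne, initWord_eq_replicate_iff]
    push Not
    rfl
  rw [Matched, hlast, PrefixUpperCond, PrefixUpperCond, ← forall_and]
  refine and_congr_right fun _ => forall_congr' fun l => ?_
  rw [← forall_and, length_initWord, length_initWord, reflect_initWord]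
  refine forall_congr' fun _ => ?_
  rw [← forall_and]
  refine forall_congr' fun hl => ?_
  rw [hblock l hl, hne l hl, hne l hl, ← not_lt, ← not_lt, initWord_lt_initWord_iff,
    initWord_lt_initWord_iff, ← prefixLT_reflectSeq_iff (x := reflectSeq (shift p z)),
    reflectSeq_reflectSeq, shift_reflectSeq]
  simp only [Fin.lt_last_iff_ne_last, reflectSeq_apply, Ne, Fin.rev_eq_iff, Fin.rev_last]

lemma matched_iff {a w : List (Fin (m + 1))} {z : ℕ → Fin (m + 1)}
    (hz : z = appendSeq w (periodicSeq a)) :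
    Matched a w ↔ (0 < w.length ∧ z (w.length - 1) < Fin.last m) ∧
      PrefixUpperCond a.length w.length (periodicSeq a) z ∧
      PrefixUpperCond a.length w.length (periodicSeq a) (reflectSeq z) := by
  subst hz
  simpa using matched_initWord_iff (n := a.length) (p := w.length)
    (z := appendSeq w (periodicSeq a))

section UpperCond

variable {n p N : ℕ} {x c b z : ℕ → Fin (m + 1)}

lemma PeriodDoubling.lt_of_not_prefixLT (h : PeriodDoubling n x c) (hy : ¬ PrefixLT n x b) :
    toLex b < toLex c :=
  (PrefixLT.trans_of_not hy h.succ.prefixLT).lt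

lemma PrefixUpperCond.upperCond (hz : PrefixUpperCond n p x z) (h : PeriodDoubling n x c)
    (hzb : AgreeOn (p + (n - 1)) z b) (hb : ∀ k, toLex (shift k (shift p b)) < toLex c) :
    UpperCond c b := by
  intro k hk
  rcases lt_or_ge (k + 1) p with hkp | hkp
  · refine h.lt_of_not_prefixLT fun hlt => ?_
    refine hz (k + 1) (by omega) hkp.le ⟨k, k.lt_succ_self, by rwa [hzb k (by omega)]⟩ ?_
    exact hlt.congr (AgreeOn.refl _ _) (AgreeOn.shift (hzb.symm.mono (by omega)))
  · obtain ⟨i, hi⟩ := Nat.exists_eq_add_of_le hkp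
    rw [hi, ← shift_shift]
    exact hb i

lemma prefixUpperCond_of_forall_lt (hx : toLex (shift 1 x) ≤ toLex x)
    (hb : ∀ k < N, b k < Fin.last m → toLex (shift (k + 1) b) < toLex x)
    (hzb : AgreeOn (N + 1 + (n - 1)) z b)
    (hz : ∀ k, toLex (shift k (shift (N + 1) z)) ≤ toLex x) : PrefixUpperCond n p x z := by
  rintro l - - ⟨j, hj, hzj⟩ hlt
  rcases le_or_gt l N with hl | hl
  · have hlb := shift_lt_of_forall_lt hx (fun k hk => hb k (by omega)) hj
      (by rwa [← hzb j (by omega)])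
    exact hlb.asymm
      (hlt.congr (AgreeOn.refl _ _) (AgreeOn.shift (hzb.mono (by omega)))).lt
  · obtain ⟨k, rfl⟩ := Nat.exists_eq_add_of_le hl
    exact (shift_shift k _ z ▸ hz k).not_gt hlt.lt

end UpperCond

/-! ### Sequences of the given form -/

section Form

variable {a : List (Fin (m + 1))} {b y : ℕ → Fin (m + 1)}
  (h : PeriodDoubling a.length (periodicSeq a) (limitSeq a))

lemma isPairProduct_factors {j : ℕ∞} {i : ℕ → ℕ} {js : ℕ → ℕ∞} {l : ℕ → ℕ} (hi : Monotone i)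
    (hl : ∀ r, l r ≤ 1) :
    IsPairProduct a (fun t => factors a j i js l (t + 1)) (fun t => i (t / 2))
      (fun t => i ((t + 1) / 2)) where
  word t := by
    rcases Nat.even_or_odd' t with ⟨r, rfl | rfl⟩
    · simp [factors, pairWord, Nat.mul_add_div]
    · simp [factors, pairWord, Nat.add_mod, Nat.mul_add_div, Nat.add_assoc]
  le t := hi (by omega)
  le_succ t := le_rfl
  eq_or_le_one t := by
    rcases Nat.even_or_odd' t with ⟨r, rfl | rfl⟩
    · exact Or.inl (by simp [Nat.mul_add_div])
    · right
      simpa [factors, Nat.add_mod, Nat.mul_add_div] using hl r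

include h

lemma tailsBetween_periodicSeq (hu : ∀ k, toLex (shift k (periodicSeq a)) ≤ toLex (periodicSeq a))
    (hl : ∀ k, toLex (reflectSeq (periodicSeq a)) < toLex (shift k (periodicSeq a))) :
    TailsBetween (limitSeq a) (periodicSeq a) := fun k =>
  ⟨(reflectSeq_lt_reflectSeq_iff.2 h.lt).trans (hl k), (hu k).trans_lt h.lt⟩

lemma tailsBetween_of_isInfProd_factors (hx : TailsBetween (limitSeq a) (periodicSeq a))
    {j : ℕ∞} {i : ℕ → ℕ} {js : ℕ → ℕ∞} {l : ℕ → ℕ} (hj : j = 0 ∨ j = ⊤) (hi : Monotone i)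
    (hl : ∀ r, l r ≤ 1) (hy : IsInfProd (factors a j i js l) y) :
    TailsBetween (limitSeq a) y ∧ AgreeOn (a.length - 1) y (periodicSeq a) ∧
      toLex (periodicSeq a) ≤ toLex y := by
  rcases hj with rfl | rfl
  · obtain ⟨hyT, hag⟩ := (isPairProduct_factors hi hl).tailsBetween h (hy.tail rfl)
    exact ⟨hyT, (hag.mono (Nat.sub_le _ 1)).trans h.succ.agreeOn.symm,
      (h.succ.prefixLT.congr (AgreeOn.refl _ _) hag.symm).lt.le⟩
  · obtain rfl : y = periodicSeq a := hy.eq_periodicSeq rfl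
    exact ⟨hx, AgreeOn.refl _ _, le_rfl⟩

lemma conditions_of_hasForm (hx : TailsBetween (limitSeq a) (periodicSeq a)) (hb : HasForm a b) :
    UpperCond (limitSeq a) b ∧ UpperCond (limitSeq a) (reflectSeq b) ∧
      ¬ UpperCond (periodicSeq a) b := by
  obtain ⟨w, j, i, js, l, y, hw, hj, hi, hl, hy, rfl⟩ := hb
  obtain ⟨hyT, hyx, hxy⟩ := tailsBetween_of_isInfProd_factors h hx hj hi.monotone hl hy
  obtain ⟨⟨hpos, hlast⟩, hw, hw'⟩ := (matched_iff rfl).1 hw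
  have hag : AgreeOn (w.length + (a.length - 1)) (appendSeq w (periodicSeq a)) (appendSeq w y) :=
    (agreeOn_appendSeq w _ _).add (by simpa using hyx.symm)
  refine ⟨hw.upperCond h hag fun k => ?_,
    hw'.upperCond h (agreeOn_reflectSeq_iff.2 hag) fun k => ?_, fun hcon => ?_⟩
  · simpa using (hyT k).2
  · simpa using reflectSeq_lt_comm.1 (hyT k).1
  · have := hcon (w.length - 1) (by rwa [← hag _ (by omega)])
    rw [Nat.sub_add_cancel hpos, shift_length_appendSeq] at this
    exact hxy.not_gt this

lemma TailsBetween.eq_periodicSeq_or_exists_limitSeq (hy : TailsBetween (limitSeq a) y)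
    (hxy : toLex (periodicSeq a) ≤ toLex y) :
    y = periodicSeq a ∨ ∃ J y', y = appendSeq (List.replicate J a).flatten y' ∧
      TailsBetween (limitSeq a) y' ∧ AgreeOn a.length y' (limitSeq a) := by
  classical
  by_cases hall : ∀ j, initWord a.length (QExpansion.shift (a.length * j) y) = a
  · exact Or.inl (eq_periodicSeq (List.length_pos_iff.1 h.succ.pos) hall)
  push Not at hall
  obtain ⟨J, hJ, hmin⟩ : ∃ J, initWord a.length (QExpansion.shift (a.length * J) y) ≠ a ∧
      ∀ j < J, initWord a.length (QExpansion.shift (a.length * j) y) = a :=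
    ⟨Nat.find hall, Nat.find_spec hall, fun j hj => not_not.1 (Nat.find_min hall hj)⟩
  have hyJ := eq_appendSeq_replicate hmin
  have hT := hy.shift (a.length * J)
  set z := QExpansion.shift (a.length * J) y
  have hxz : toLex (periodicSeq a) ≤ toLex z := by
    rw [hyJ, ← appendSeq_flatten_replicate_periodicSeq a J] at hxy
    exact not_lt.1 ((appendSeq_lt_appendSeq_iff _).not.1 hxy.not_gt)
  have hzc : toLex z ≤ toLex (limitSeq a) := (hy (a.length * J)).2.le
  refine Or.inr ⟨J, z, hyJ, hT, (h.succ.agreeOn_or_agreeOn hxz hzc).resolve_left fun hzx => hJ ?_⟩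
  rw [initWord_eq_initWord_iff.2 hzx, initWord_periodicSeq]

section FirstViolation

variable {N : ℕ} (hu : ∀ k, toLex (shift k (periodicSeq a)) ≤ toLex (periodicSeq a))
  (hl : ∀ k, toLex (reflectSeq (periodicSeq a)) < toLex (shift k (periodicSeq a)))
include hu hl

lemma tailsBetween_shift_of_upperCond (hb : UpperCond (limitSeq a) b)
    (hb' : UpperCond (limitSeq a) (reflectSeq b)) (hN : b N < Fin.last m)
    (hbad : toLex (periodicSeq a) ≤ toLex (shift (N + 1) b)) :
    TailsBetween (limitSeq a) (shift (N + 1) b) := by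
  have hhead : 0 < b (N + 1) := by
    obtain ⟨j, -, hj⟩ := toLex_lt_iff.1 (hl 0)
    calc 0 < periodicSeq a j := by simpa using (Fin.zero_le _).trans_lt hj
      _ ≤ periodicSeq a 0 := Pi.apply_le_of_toLex (x := shift j _) (i := 0) (hu j) (by simp)
      _ ≤ b (N + 1) := Pi.apply_le_of_toLex (i := 0) hbad (by simp)
  have hc : toLex (shift 1 (limitSeq a)) ≤ toLex (limitSeq a) := (h.shift_lt one_pos).le
  intro k
  refine ⟨?_, ?_⟩
  · rcases Nat.eq_zero_or_pos k with rfl | hk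
    · rw [shift_zero]
      exact ((reflectSeq_lt_reflectSeq_iff.2 h.lt).trans (hl 0)).trans_le (by simpa using hbad)
    · rw [shift_shift, reflectSeq_lt_comm, ← shift_reflectSeq]
      exact shift_lt_of_forall_lt hc (fun n _ => hb' n) (Nat.lt_add_of_pos_right hk)
        (by simpa [Fin.lt_last_iff_ne_last, Fin.rev_eq_iff] using hhead.ne')
  · rw [shift_shift]
    exact shift_lt_of_forall_lt hc (fun n _ => hb n) (by omega) hN

lemma matched_initWord_append (hN : b N < Fin.last m)
    (hmin : ∀ k < N, b k < Fin.last m → toLex (shift (k + 1) b) < toLex (periodicSeq a))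
    (hmin' : ∀ k < N, reflectSeq b k < Fin.last m →
      toLex (shift (k + 1) (reflectSeq b)) < toLex (periodicSeq a))
    (hag : AgreeOn (a.length - 1) (shift (N + 1) b) (periodicSeq a)) (J : ℕ) :
    Matched a (initWord (N + 1) b ++ (List.replicate J a).flatten) := by
  set z := appendSeq (initWord (N + 1) b) (periodicSeq a)
  have hzx : shift (N + 1) z = periodicSeq a := shift_appendSeq_initWord _ _ _
  have hzb : AgreeOn (N + 1 + (a.length - 1)) z b :=
    (agreeOn_appendSeq_initWord _ _ _).add (by rw [hzx]; exact hag.symm)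
  have hlast : z (N + 1 + J * a.length - 1) < Fin.last m := by
    cases J with
    | zero => simpa [hzb N (by omega)] using hN
    | succ J =>
      have hpos := h.succ.pos
      have hval : z (N + 1 + (J + 1) * a.length - 1) = periodicSeq a (a.length - 1) := by
        rw [show N + 1 + (J + 1) * a.length - 1 = N + 1 + (a.length * J + (a.length - 1)) by
          rw [Nat.succ_mul, Nat.mul_comm J]; omega, ← shift_apply (x := z), hzx]
        simp [periodicSeq]
      have := h.succ.last
      have := (limitSeq a (a.length - 1)).is_le
      rw [hval, Fin.lt_def, Fin.val_last]
      omega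
  refine (matched_iff (z := z) ?_).2 ⟨⟨by simp, by simpa using hlast⟩, ?_, ?_⟩
  · rw [appendSeq_append, appendSeq_flatten_replicate_periodicSeq]
  · exact prefixUpperCond_of_forall_lt (hu 1) hmin hzb (by rwa [hzx])
  · refine prefixUpperCond_of_forall_lt (hu 1) hmin' (agreeOn_reflectSeq_iff.2 hzb) fun k => ?_
    rw [shift_reflectSeq, hzx, shift_reflectSeq]
    exact (reflectSeq_lt_comm.1 (hl k)).le

lemma hasForm_of_first_violation (hb : UpperCond (limitSeq a) b)
    (hb' : UpperCond (limitSeq a) (reflectSeq b)) (hN : b N < Fin.last m)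
    (hbad : toLex (periodicSeq a) ≤ toLex (shift (N + 1) b))
    (hmin : ∀ k < N, b k < Fin.last m → toLex (shift (k + 1) b) < toLex (periodicSeq a))
    (hmin' : ∀ k < N, reflectSeq b k < Fin.last m →
      toLex (shift (k + 1) (reflectSeq b)) < toLex (periodicSeq a)) : HasForm a b := by
  have hyT := tailsBetween_shift_of_upperCond h hu hl hb hb' hN hbad
  have hag : AgreeOn (a.length - 1) (shift (N + 1) b) (periodicSeq a) :=
    (h.succ.agreeOn_or_agreeOn hbad (by simpa using (hyT 0).2.le)).elim
      (AgreeOn.mono · (Nat.sub_le _ 1))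
      fun hyc => (hyc.mono (Nat.sub_le _ 1)).trans h.succ.agreeOn.symm
  have hmatched := matched_initWord_append h hu hl hN hmin hmin' hag
  have hsplit := (appendSeq_initWord_shift (N + 1) b).symm
  rcases hyT.eq_periodicSeq_or_exists_limitSeq h hbad with hper | ⟨J, y, hy, hyT', hyc⟩
  · rw [hper] at hsplit
    exact ⟨_, ⊤, id, fun _ => 0, fun _ => 0, _, by simpa using hmatched 0, Or.inr rfl,
      strictMono_id, fun _ => zero_le_one, isInfProd_of_top rfl, hsplit⟩
  · obtain ⟨i, js, l, hi, hl1, hprod⟩ := hyT'.exists_isInfProd h hyc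
    rw [hy, ← appendSeq_append] at hsplit
    exact ⟨_, 0, i, js, l, y, hmatched J, Or.inl rfl, hi, hl1, hprod, hsplit⟩

lemma hasForm_of_conditions (hb : UpperCond (limitSeq a) b)
    (hb' : UpperCond (limitSeq a) (reflectSeq b))
    (hnot : ¬ (UpperCond (periodicSeq a) b ∧ UpperCond (periodicSeq a) (reflectSeq b))) :
    HasForm a b ∨ HasForm a (reflectSeq b) := by
  classical
  let Good (b : ℕ → Fin (m + 1)) (k : ℕ) : Prop :=
    b k < Fin.last m → toLex (shift (k + 1) b) < toLex (periodicSeq a)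
  have hex : ∃ k, ¬ (Good b k ∧ Good (reflectSeq b) k) := by
    by_contra! hgood
    exact hnot ⟨fun k => (hgood k).1, fun k => (hgood k).2⟩
  have hmin (k : ℕ) (hk : k < Nat.find hex) : Good b k ∧ Good (reflectSeq b) k :=
    not_not.1 (Nat.find_min hex hk)
  rcases not_and_or.1 (Nat.find_spec hex) with hbad | hbad <;>
    obtain ⟨hN, hbad⟩ := Classical.not_imp.1 hbad
  · exact Or.inl (hasForm_of_first_violation h hu hl hb hb' hN (not_lt.1 hbad)
      (fun k hk => (hmin k hk).1) fun k hk => (hmin k hk).2)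
  · refine Or.inr (hasForm_of_first_violation h hu hl hb' ?_ hN (not_lt.1 hbad)
      (fun k hk => (hmin k hk).2) ?_) <;> rw [reflectSeq_reflectSeq]
    exacts [hb, fun k hk => (hmin k hk).1]

end FirstViolation

end Form

end QExpansion

theorem theorem5p4 (m : ℕ) (hm : 1 ≤ m) (q₀ q₀' : ℝ)
    (hcomp : QExpansion.IsComponentInterval (QExpansion.complementSet m) q₀ q₀')
    (hM : (((m / 2 + 1 : ℕ)) : ℝ) < q₀)
    (α : ℕ → Fin (m + 1)) (hα : QExpansion.IsQuasiGreedy q₀ 1 α)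
    (a : List (Fin (m + 1))) (ha : QExpansion.IsSmallestBlock a α)
    (b : ℕ → Fin (m + 1)) :
    b ∈ QExpansion.univoqueSeqs m q₀' \ QExpansion.univoqueSeqs m q₀ ↔
      QExpansion.HasForm a b ∨ QExpansion.HasForm a (QExpansion.reflectSeq b) := by
  have hq := QExpansion.one_lt_of_half_add_one_lt hM
  have gap := hcomp.isUnivoqueGap hM
  have h := gap.periodDoubling hM hα ha
  obtain ⟨_, rfl, _⟩ := ha
  have hα' := h.isQuasiGreedy_right hq hα gap
  have hu := hα.shift_le hq
  have hl := gap.reflectSeq_lt_shift hM hα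
  have hx := QExpansion.tailsBetween_periodicSeq h hu hl
  have key (c) (hc : QExpansion.HasForm a c) :
      c ∈ QExpansion.univoqueSeqs m q₀' \ QExpansion.univoqueSeqs m q₀ := by
    obtain ⟨hc₁, hc₂, hc₃⟩ := QExpansion.conditions_of_hasForm h hx hc
    exact ⟨(QExpansion.mem_univoqueSeqs_iff (hq.trans gap.lt) hα').2 ⟨hc₁, hc₂⟩,
      fun hmem => hc₃ ((QExpansion.mem_univoqueSeqs_iff hq hα).1 hmem).1⟩
  refine ⟨fun ⟨hb, hnot⟩ => ?_, fun hb => hb.elim (key b) fun hb => ?_⟩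
  · rw [QExpansion.mem_univoqueSeqs_iff (hq.trans gap.lt) hα'] at hb
    rw [QExpansion.mem_univoqueSeqs_iff hq hα] at hnot
    exact QExpansion.hasForm_of_conditions h hu hl hb.1 hb.2 hnot
  · have hmem := key _ hb
    rwa [Set.mem_sdiff, QExpansion.reflectSeq_mem_univoqueSeqs_iff (hq.trans gap.lt),
      QExpansion.reflectSeq_mem_univoqueSeqs_iff hq] at hmem
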